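/- **Proposition.** The flute surface is the sphere minus a convergent sequence of distinct points and its limit, i.e. any surface homeomorphic to $\mathbb{C}\setminus\mathbb{N}$. An *arc* on a surface $X$ is a proper embedding $\mathbb{R}\to X$ each of whose two ends converges to an end of $X$. An *ideal triangulation* of $X$ is a locally finite collection $\{\mu_i\}_{i\in\mathbb{N}}$ of pairwise disjoint arcs such that each component of $X\setminus\bigcup_i\mu_i$ is an open disk bounded by at most three sides of arcs (that is, it is the interior of a properly mapped closed disk minus at most three boundary points, each boundary side of which is mapped homeomorphically onto an arc). 1. Every surface homeomorphic to the flute surface admits an ideal triangulation. 2. Consider the Farey triangulation of the open unit disk $D$ in the projective (Klein) model: its vertices are the images of $\mathbb{Q}\cup\{\infty\}$ under the Cayley transform $z\mapsto (z-i)/(z+i)$, its edges are the open chords joining the images of $p/q$ and $r/s$ with $|ps-qr|=1$, and its triangles are the open triangles whose three vertices are pairwise joined by edges. Choose any point $c_T$ in each open Farey triangle $T$. Then $F=D\setminus\{c_T\}_T$ is homeomorphic to the flute surface, and $F$ has an ideal triangulation whose arcs are exactly the Farey edges together with, for each Farey triangle $T$, the three open segments from $c_T$ to the vertices of $T$. 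-/

import Mathlib

namespace Flute

/-- A topological end of `X`, given by a representing nested sequence: connected open sets with
compact frontier which decrease and eventually leave every compact set. -/
structure EndSeq (X : Type*) [TopologicalSpace X] where
  nbhd : ℕ → Set X
  isOpen : ∀ i, IsOpen (nbhd i)
  isConnected : ∀ i, IsConnected (nbhd i)
  isCompact_frontier : ∀ i, IsCompact (frontier (nbhd i))
  antitone : Antitone nbhd
  leaves : ∀ K : Set X, IsCompact K → ∃ i, Disjoint (nbhd i) K

/-- An arc: a proper embedding of the line, each of whose two ends converges to an end
of `X` (the two ends of `X` may coincide). -/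
structure IsArc {X : Type*} [TopologicalSpace X] (α : ℝ → X) : Prop where
  proper : IsProperMap α
  embedding : Topology.IsEmbedding α
  end_pos : ∃ e : EndSeq X, ∀ i, ∀ᶠ t in Filter.atTop, α t ∈ e.nbhd i
  end_neg : ∃ e : EndSeq X, ∀ i, ∀ᶠ t in Filter.atBot, α t ∈ e.nbhd i

/-- `C` is a disk bounded by at most three sides of the arcs `μ i`: it is the interior of an
immersed ideal polygon with at most three sides.

The model polygon is the closed unit disk without a set `W` of at most three points of the unit
circle (the ideal vertices); its sides are the connected components of the unit circle minus `W`.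
The polygon maps properly to `X`, its interior bijectively onto `C`, and each of its sides
bijectively onto an arc. Different sides may go to the same arc, when `C` lies on both sides of
that arc. Since the map is proper, these bijections are homeomorphisms. -/
def IsBoundedByAtMostThreeSides {X : Type*} [TopologicalSpace X] (μ : ℕ → ℝ → X)
    (C : Set X) : Prop :=
  ∃ (W : Finset ℂ) (f : ℂ → X),
    W.card ≤ 3 ∧ (W : Set ℂ) ⊆ Metric.sphere 0 1 ∧
    IsProperMap ((Metric.closedBall (0 : ℂ) 1 \ (W : Set ℂ)).domRestrict f) ∧
    Set.BijOn f (Metric.ball 0 1) C ∧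
    ∀ z ∈ Metric.sphere (0 : ℂ) 1 \ (W : Set ℂ), ∃ i,
      Set.BijOn f (connectedComponentIn (Metric.sphere (0 : ℂ) 1 \ (W : Set ℂ)) z)
        (Set.range (μ i))

/-- An ideal triangulation of `X`: a locally finite collection of pairwise disjoint arcs such that
each component of the complement is an open disk bounded by at most three sides of arcs. -/
structure IsIdealTriangulation {X : Type*} [TopologicalSpace X] (μ : ℕ → ℝ → X) : Prop where
  arc : ∀ i, IsArc (μ i)
  disjoint : ∀ i j, i ≠ j → Disjoint (Set.range (μ i)) (Set.range (μ j))
  locallyFinite : LocallyFinite fun i => Set.range (μ i)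
  isOpen_component : ∀ x ∈ (⋃ i, Set.range (μ i))ᶜ,
    IsOpen (connectedComponentIn (⋃ i, Set.range (μ i))ᶜ x)
  disk : ∀ x ∈ (⋃ i, Set.range (μ i))ᶜ,
    Nonempty (connectedComponentIn (⋃ i, Set.range (μ i))ᶜ x ≃ₜ Metric.ball (0 : ℂ) 1)
  sides : ∀ x ∈ (⋃ i, Set.range (μ i))ᶜ,
    IsBoundedByAtMostThreeSides μ (connectedComponentIn (⋃ i, Set.range (μ i))ᶜ x)

/-- The flute surface, up to homeomorphism: the sphere minus a convergent sequence and its limit,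
i.e. (with the limit at infinity) the plane minus the natural numbers. -/
def IsFluteSurface (X : Type*) [TopologicalSpace X] : Prop :=
  Nonempty (X ≃ₜ ((Set.range fun n : ℕ => (n : ℂ))ᶜ : Set ℂ))

/-- The point of the unit circle that corresponds to the boundary point `p / q` of the upper half
plane (`1 / 0` being infinity) under the Cayley transform `z ↦ (z - i) / (z + i)`. -/
noncomputable def fareyPoint (u : ℤ × ℤ) : ℂ :=
  ((u.1 : ℂ) - u.2 * Complex.I) / ((u.1 : ℂ) + u.2 * Complex.I)

/-- `p / q` and `r / s` are Farey neighbours: `p s - q r = ± 1`. -/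
def FareyAdj (u v : ℤ × ℤ) : Prop :=
  |u.1 * v.2 - u.2 * v.1| = 1

/-- The edges of the Farey triangulation of the open unit disk, in the projective (Klein) model,
where geodesics are open chords. -/
def fareyEdges : Set (Set ℂ) :=
  {S | ∃ u v : ℤ × ℤ, FareyAdj u v ∧ S = openSegment ℝ (fareyPoint u) (fareyPoint v)}

/-- The triangles of the Farey triangulation, each given by its set of (three ideal) vertices. The
open triangle with vertex set `V` is `interior (convexHull ℝ V)`. -/
def fareyTriangles : Set (Set ℂ) :=
  {V | ∃ u v w : ℤ × ℤ, FareyAdj u v ∧ FareyAdj v w ∧ FareyAdj w u ∧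
    V = {fareyPoint u, fareyPoint v, fareyPoint w}}

/-- The open unit disk with the points `c V`, one for each Farey triangle `V`, removed. -/
def puncturedDisk (c : fareyTriangles → ℂ) : Set ℂ :=
  Metric.ball 0 1 \ Set.range c

/-- The spokes: in each Farey triangle the three open segments from the puncture to the ideal
vertices. -/
def spokes (c : fareyTriangles → ℂ) : Set (Set ℂ) :=
  {S | ∃ V : fareyTriangles, ∃ v ∈ (V : Set ℂ), S = openSegment ℝ (c V) v}

end Flute

/-!
The punctured disk is triangulated first. A point `z` of the disk is a positive definite symmetric
`2 × 2` matrix of trace one, and the Farey point of an integer vector `x` is the rank one matrix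
`x xᵀ / |x|²`; chords and straight triangles of the disk become convex combinations of such
matrices. The affine function `chordForm u v`, whose value at the Farey point of `x` is
`[x u] [x v] / |x|²` with brackets for determinants, vanishes on the chord from `u` to `v`.

* Farey edges do not cross, by the Plücker relation for determinants (`FareyAdj.not_cross`). Hence
  edges are disjoint (`openSegment_eq_of_mem_of_mem`), triangles are disjoint from edges
  (`disjoint_triangle_edge`) and from each other (`triangle_eq_of_mem_of_mem`).
* Edges and triangles cover the disk, by Selling's reduction of positive definite binary forms
  (`exists_obtuse_superbase`, `mem_edge_or_mem_triangle`).
* They are locally finite in the open disk, since the edge from `u` to `v` has length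
  `2 / (|u| |v|)` (`nsq_le_of_convexHull_inter`).

The three spokes subdivide each Farey triangle, as the comparison of barycentric coordinates with
those of the puncture shows (`mem_subdivision`). Thus edges and spokes form a straight
triangulation of the punctured disk (`isStraightTriangulation_puncturedDisk`). The ends of the
segments converge to ends of the surface, because punctures have small disks about them and the
unit circle is approached by annuli, all of which stay connected after removal of countably many
points. The complementary components are the open triangles, and a homeomorphism of the plane that
carries a triangle to the disk exhibits them as ideal polygons
(`IsStraightTriangulation.exists_isIdealTriangulation`).

The punctured disk is a flute surface because the disk is homeomorphic to the plane and an infinite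
closed discrete subset of the plane can be moved to the natural numbers by a homeomorphism of the
plane (`exists_homeomorph_image_eq_range_natCast`). An arbitrary flute surface is
therefore homeomorphic to a punctured disk, from which the triangulation is transported
(`IsIdealTriangulation.comp_homeomorph`).
-/

open Set Filter Topology Metric

namespace Flute

/-! ### Moving a discrete subset of the plane to the natural numbers -/

/-- The map of the plane that keeps arguments and applies `k` to the modulus. -/
noncomputable def radialMap (k : ℝ → ℝ) (z : ℂ) : ℂ := ((k ‖z‖ / ‖z‖ : ℝ) : ℂ) * z

lemma norm_radialMap {k : ℝ → ℝ} (hk : StrictMono k) (h0 : k 0 = 0) (z : ℂ) :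
    ‖radialMap k z‖ = k ‖z‖ := by
  have hpos : 0 ≤ k ‖z‖ := h0 ▸ hk.monotone (norm_nonneg z)
  rcases eq_or_ne z 0 with rfl | hz
  · simp [radialMap, h0]
  · have : ‖z‖ ≠ 0 := norm_ne_zero_iff.2 hz
    rw [radialMap, norm_mul, Complex.norm_real, Real.norm_of_nonneg (by positivity)]
    field_simp

lemma radialMap_radialMap {k l : ℝ → ℝ} (hk : StrictMono k) (h0 : k 0 = 0)
    (hl : ∀ x, l (k x) = x) (z : ℂ) : radialMap l (radialMap k z) = z := by
  rcases eq_or_ne z 0 with rfl | hz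
  · simp [radialMap]
  · have h1 : ‖z‖ ≠ 0 := norm_ne_zero_iff.2 hz
    have h2 : k ‖z‖ ≠ 0 := (h0 ▸ hk (norm_pos_iff.2 hz) : 0 < k ‖z‖).ne'
    rw [radialMap, norm_radialMap hk h0, hl, radialMap, ← mul_assoc, ← Complex.ofReal_mul]
    have : ‖z‖ / k ‖z‖ * (k ‖z‖ / ‖z‖) = 1 := by field_simp
    rw [this]; simp

lemma continuous_radialMap {k : ℝ → ℝ} (hk : StrictMono k) (h0 : k 0 = 0) (hc : Continuous k) :
    Continuous (radialMap k) := by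
  refine continuous_iff_continuousAt.2 fun z => ?_
  rcases eq_or_ne z 0 with rfl | hz
  · have h : radialMap k 0 = 0 := by simp [radialMap]
    rw [ContinuousAt, h, tendsto_zero_iff_norm_tendsto_zero]
    simp only [norm_radialMap hk h0]
    have : Continuous fun z : ℂ => k ‖z‖ := by fun_prop
    simpa [h0] using this.tendsto 0
  · have h1 : ‖z‖ ≠ 0 := norm_ne_zero_iff.2 hz
    unfold radialMap
    refine ContinuousAt.mul (Complex.continuous_ofReal.continuousAt.comp ?_) continuousAt_id
    exact ContinuousAt.div (by fun_prop) (by fun_prop) h1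

/-- An increasing homeomorphism of the line fixing `0` induces a radial homeomorphism of the
plane. -/
noncomputable def radialHomeomorph (k : ℝ ≃o ℝ) (h0 : k 0 = 0) : ℂ ≃ₜ ℂ where
  toFun := radialMap k
  invFun := radialMap k.symm
  left_inv := radialMap_radialMap k.strictMono h0 k.symm_apply_apply
  right_inv := radialMap_radialMap k.symm.strictMono (k.symm_apply_eq.2 h0.symm) k.apply_symm_apply
  continuous_toFun := continuous_radialMap k.strictMono h0 k.continuous
  continuous_invFun := continuous_radialMap k.symm.strictMono (k.symm_apply_eq.2 h0.symm)
    k.symm.continuous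

/-- The twist of the plane that rotates the circle of radius `r` by the angle `θ r`. -/
noncomputable def twistHomeomorph (θ : C(ℝ, ℝ)) : ℂ ≃ₜ ℂ where
  toFun z := Complex.exp (θ ‖z‖ * Complex.I) * z
  invFun z := Complex.exp (-θ ‖z‖ * Complex.I) * z
  left_inv z := by
    have : ‖Complex.exp (θ ‖z‖ * Complex.I) * z‖ = ‖z‖ := by
      rw [norm_mul, Complex.norm_exp_ofReal_mul_I, one_mul]
    simp only [this, ← mul_assoc, ← Complex.exp_add]
    simp
  right_inv z := by
    have : ‖Complex.exp (-θ ‖z‖ * Complex.I) * z‖ = ‖z‖ := by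
      rw [norm_mul, ← Complex.ofReal_neg, Complex.norm_exp_ofReal_mul_I, one_mul]
    simp only [this, ← mul_assoc, ← Complex.exp_add]
    simp
  continuous_toFun := by fun_prop
  continuous_invFun := by fun_prop

/-- A strictly increasing bi-infinite real sequence, unbounded in both directions, is the
restriction to the integers of an increasing homeomorphism of the line: interpolate linearly. -/
lemma exists_orderIso_interpolating (s : ℤ → ℝ) (hs : StrictMono s)
    (htop : ∀ t, ∃ n, t < s n) (hbot : ∀ t, ∃ n, s n ≤ t) :
    ∃ G : ℝ ≃o ℝ, ∀ n : ℤ, G n = s n := by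
  let G : ℝ → ℝ := fun x => s ⌊x⌋ + Int.fract x * (s (⌊x⌋ + 1) - s ⌊x⌋)
  have hstep : ∀ n, 0 < s (n + 1) - s n := fun n => sub_pos.2 (hs (lt_add_one n))
  have hlt : ∀ x, G x < s (⌊x⌋ + 1) := fun x => by
    have := mul_lt_mul_of_pos_right (Int.fract_lt_one x) (hstep ⌊x⌋)
    simp only [G]; linarith
  have hle : ∀ x, s ⌊x⌋ ≤ G x := fun x =>
    le_add_of_nonneg_right (mul_nonneg (Int.fract_nonneg x) (hstep _).le)
  have hmono : StrictMono G := by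
    intro x y hxy
    rcases (Int.floor_mono hxy.le).eq_or_lt with h | h
    · have hf : Int.fract x < Int.fract y := by
        simp only [Int.fract]; rw [h]; linarith
      have := mul_lt_mul_of_pos_right hf (hstep ⌊x⌋)
      simp only [G]; rw [← h]; linarith
    · exact (hlt x).trans_le ((hs.monotone h).trans (hle y))
  have hsurj : Function.Surjective G := by
    intro t
    obtain ⟨b, hb⟩ := htop t
    obtain ⟨n, hn, hmax⟩ := Int.exists_greatest_of_bdd (P := fun n => s n ≤ t)
      ⟨b, fun z hz => (hs.lt_iff_lt.1 (hz.trans_lt hb)).le⟩ (hbot t)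
    have hn' : t < s (n + 1) := by
      by_contra h
      have := hmax (n + 1) (not_lt.1 h)
      omega
    have hfr : (t - s n) / (s (n + 1) - s n) < 1 := by
      rw [div_lt_one (hstep n)]; linarith
    have hfr0 : 0 ≤ (t - s n) / (s (n + 1) - s n) :=
      div_nonneg (by linarith) (hstep n).le
    have hfl : ⌊(n : ℝ) + (t - s n) / (s (n + 1) - s n)⌋ = n := by
      rw [Int.floor_intCast_add, Int.floor_eq_zero_iff.2 ⟨hfr0, hfr⟩, add_zero]
    refine ⟨n + (t - s n) / (s (n + 1) - s n), ?_⟩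
    simp only [G, Int.fract]
    rw [hfl]
    have := (hstep n).ne'
    field_simp
    ring
  exact ⟨hmono.orderIsoOfSurjective G hsurj, fun n => by
    change G n = s n
    simp [G]⟩

/-- An infinite set of positive reals with finitely many elements below each bound is the set of
values of an increasing homeomorphism of the line, fixing `0`, at the positive integers. -/
lemma exists_orderIso_image_nat (R : Set ℝ) (hpos : ∀ r ∈ R, 0 < r) (hinf : R.Infinite)
    (hfin : ∀ b, (R ∩ Iic b).Finite) :
    ∃ G : ℝ ≃o ℝ, G 0 = 0 ∧ R = range fun n : ℕ => G (n + 1) := by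
  classical
  obtain ⟨m, hm⟩ : ∃ m : R, ∀ r : R, m ≤ r := by
    obtain ⟨r₀, hr₀⟩ := hinf.nonempty
    obtain ⟨m, hm, hmin⟩ := (hfin r₀).exists_minimal ⟨r₀, hr₀, mem_Iic.2 le_rfl⟩
    refine ⟨⟨m, hm.1⟩, fun r => ?_⟩
    by_contra! hlt
    have hlt' : (r : ℝ) < m := hlt
    exact hlt'.not_ge (hmin ⟨r.2, hlt'.le.trans hm.2⟩ hlt'.le)
  let _ : OrderBot R := { bot := m, bot_le := hm }
  let _ : LocallyFiniteOrder R := LocallyFiniteOrder.ofFiniteIcc fun a b => by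
    refine Set.Finite.of_finite_image ((hfin b).subset ?_) Subtype.val_injective.injOn
    rintro _ ⟨x, hx, rfl⟩
    exact ⟨x.2, hx.2⟩
  have : NoMaxOrder R := ⟨fun a => by
    by_contra! h
    exact hinf ((hfin a).subset fun x hx => ⟨hx, h ⟨x, hx⟩⟩)⟩
  let _ := LinearLocallyFiniteOrder.succOrder R
  let _ := LinearLocallyFiniteOrder.predOrder R
  let e : R ≃o ℕ := orderIsoNatOfLinearSuccPredArch
  let r : ℕ → ℝ := fun n => e.symm n
  have hr : StrictMono r := fun a b hab => e.symm.strictMono hab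
  have hrange : R = range r := by
    ext x
    exact ⟨fun hx => ⟨e ⟨x, hx⟩, by simp [r]⟩, by rintro ⟨n, rfl⟩; exact (e.symm n).2⟩
  have hunb : ∀ t, ∃ n, t < r n := by
    intro t
    by_contra! h
    refine hinf ((hfin t).subset fun x hx => ⟨hx, ?_⟩)
    rw [hrange] at hx
    obtain ⟨n, rfl⟩ := hx
    exact h n
  let s : ℤ → ℝ := fun n => if n ≤ 0 then n else r (n - 1).toNat
  have hs : StrictMono s := by
    refine strictMono_int_of_lt_succ fun n => ?_
    by_cases h1 : n + 1 ≤ 0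
    · have h2 : n ≤ 0 := by omega
      simp [s, h1, h2]
    · by_cases h2 : n ≤ 0
      · have h3 : n = 0 := by omega
        subst h3
        simpa [s] using hpos _ (e.symm 0).2
      · simp only [s, h1, h2, if_false]
        exact hr (by omega)
  obtain ⟨G, hG⟩ := exists_orderIso_interpolating s hs
    (fun t => by
      obtain ⟨n, hn⟩ := hunb t
      refine ⟨n + 1, ?_⟩
      have : ¬ ((n : ℤ) + 1 ≤ 0) := by omega
      simpa [s, this] using hn)
    (fun t => by
      refine ⟨min 0 ⌊t⌋, ?_⟩
      simp only [s, min_le_left, if_true]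
      exact (Int.cast_le.2 (min_le_right _ _)).trans (Int.floor_le t))
  refine ⟨G, by simpa [s] using hG 0, ?_⟩
  rw [hrange]
  congr 1
  ext n
  have h1 := hG (n + 1)
  have h2 : ¬ ((n : ℤ) + 1 ≤ 0) := by omega
  simp only [s, h2, if_false] at h1
  push_cast at h1
  rw [h1]
  simp

/-- Some point is not in a given countable set and has different distances to all the points of
this set: perpendicular bisectors are null sets. -/
lemma exists_generic_center (A : Set ℂ) (hA : A.Countable) :
    ∃ p, p ∉ A ∧ InjOn (fun a => dist a p) A := by
  have hnull : MeasureTheory.volume (A ∪ ⋃ x ∈ A, ⋃ y ∈ A \ {x},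
      (AffineSubspace.perpBisector x y : Set ℂ)) = 0 := by
    refine MeasureTheory.measure_union_null (hA.measure_zero _) ?_
    refine (MeasureTheory.measure_biUnion_null_iff hA).2 fun x _ => ?_
    refine (MeasureTheory.measure_biUnion_null_iff (hA.mono sdiff_subset)).2 fun y hy => ?_
    refine MeasureTheory.Measure.addHaar_affineSubspace _ _ ?_
    rw [Ne, AffineSubspace.perpBisector_eq_top]
    exact fun h => hy.2 h.symm
  obtain ⟨p, hp⟩ : ∃ p, p ∉ A ∪ ⋃ x ∈ A, ⋃ y ∈ A \ {x},
      (AffineSubspace.perpBisector x y : Set ℂ) := by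
    by_contra! h
    rw [eq_univ_of_forall h] at hnull
    simp at hnull
  refine ⟨p, fun h => hp (Or.inl h), fun x hx y hy hxy => ?_⟩
  by_contra hne
  refine hp (Or.inr ?_)
  simp only [mem_iUnion]
  refine ⟨x, hx, y, ⟨hy, fun h => hne h.symm⟩, ?_⟩
  rw [SetLike.mem_coe, AffineSubspace.mem_perpBisector_iff_dist_eq']
  exact hxy

/-- Every infinite closed discrete subset of the plane is carried to the natural numbers by a
homeomorphism of the plane: about a generic centre its points lie on different circles; a radial
homeomorphism gives these circles the radii `1, 2, 3, …`, and a twist moves the points on them to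
the positive real axis. -/
theorem exists_homeomorph_image_eq_range_natCast (A : Set ℂ) (hinf : A.Infinite)
    (hfin : ∀ r, (A ∩ closedBall 0 r).Finite) :
    ∃ h : ℂ ≃ₜ ℂ, h '' A = range ((↑) : ℕ → ℂ) := by
  have hcount : A.Countable := by
    have : A = ⋃ n : ℕ, A ∩ closedBall 0 n := by
      rw [← inter_iUnion, iUnion_closedBall_nat, inter_univ]
    rw [this]
    exact countable_iUnion fun n => (hfin n).countable
  obtain ⟨p, hpA, hinj⟩ := exists_generic_center A hcount
  obtain ⟨G, hG0, hG⟩ := exists_orderIso_image_nat ((fun a => dist a p) '' A)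
    (by
      rintro _ ⟨a, ha, rfl⟩
      exact dist_pos.2 fun h => hpA (h ▸ ha))
    (hinf.image hinj)
    (fun b => by
      refine ((hfin (b + ‖p‖)).image fun a => dist a p).subset ?_
      rintro _ ⟨⟨a, ha, rfl⟩, hb⟩
      refine ⟨a, ⟨ha, ?_⟩, rfl⟩
      have h1 : dist a p ≤ b := hb
      rw [mem_closedBall]
      have h2 := dist_triangle a p 0
      rw [dist_zero_right p] at h2
      linarith)
  -- `a n` is the point of `A` on the `n`-th circle about `p`.
  have hmem : ∀ n : ℕ, ∃ a ∈ A, dist a p = G (n + 1) := fun n => by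
    have : G (n + 1) ∈ (fun a => dist a p) '' A := hG ▸ mem_range_self n
    exact this
  choose a haA had using hmem
  have hAa : A = range a := by
    refine Subset.antisymm (fun x hx => ?_) (range_subset_iff.2 haA)
    have : dist x p ∈ range fun n : ℕ => G (n + 1) := hG ▸ mem_image_of_mem _ hx
    obtain ⟨n, hn⟩ := this
    exact ⟨n, hinj (haA n) hx ((had n).trans hn)⟩
  obtain ⟨θ, hθ⟩ := ContinuousMap.exists_extension' (Y := ℝ) Int.isClosedEmbedding_coe_real
    (⟨fun n : ℤ => -(a (n - 1).toNat - p).arg, continuous_of_discreteTopology⟩ : C(ℤ, ℝ))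
  have hG0' : G.symm 0 = 0 := G.symm_apply_eq.2 hG0.symm
  refine ⟨((Homeomorph.subRight p).trans (radialHomeomorph G.symm hG0')).trans
    ((twistHomeomorph θ).trans (Homeomorph.subRight 1)), ?_⟩
  rw [hAa, ← range_comp]
  congr 1
  ext1 n
  have hθn : θ (n + 1) = -(a n - p).arg := by
    have := congrFun hθ (n + 1)
    simpa using this
  have hnorm : ‖radialMap G.symm (a n - p)‖ = n + 1 := by
    rw [norm_radialMap G.symm.strictMono hG0', ← dist_eq_norm, had]; simp
  have hne : ((‖a n - p‖ : ℝ) : ℂ) ≠ 0 := by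
    rw [Complex.ofReal_ne_zero, norm_ne_zero_iff, sub_ne_zero]
    exact fun h => hpA (h ▸ haA n)
  have hGn : G.symm ‖a n - p‖ = n + 1 := by rw [← dist_eq_norm, had]; simp
  change Complex.exp (θ ‖radialMap G.symm (a n - p)‖ * Complex.I) *
    radialMap G.symm (a n - p) - 1 = n
  rw [hnorm, hθn, radialMap, hGn]
  have hpolar := Complex.norm_mul_exp_arg_mul_I (a n - p)
  nth_rewrite 3 [← hpolar]
  have hexp : Complex.exp ((-(a n - p).arg : ℝ) * Complex.I) *
      Complex.exp ((a n - p).arg * Complex.I) = 1 := by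
    rw [← Complex.exp_add]; simp
  push_cast at hexp ⊢
  rw [neg_mul] at hexp
  field_simp
  linear_combination (n + 1 : ℂ) * hexp

/-! ### Triangles in the plane -/

/-- Twice the signed area of the triangle `A B C`. -/
def signedArea (A B C : ℂ) : ℝ := (B - A).re * (C - A).im - (B - A).im * (C - A).re

lemma signedArea_rotate (A B C : ℂ) : signedArea B C A = signedArea A B C := by
  simp only [signedArea, Complex.sub_re, Complex.sub_im]; ring

lemma signedArea_swap (A B C : ℂ) : signedArea B A C = -signedArea A B C := by
  simp only [signedArea, Complex.sub_re, Complex.sub_im]; ring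

lemma continuous_signedArea (B C : ℂ) : Continuous fun z => signedArea z B C := by
  unfold signedArea
  fun_prop

/-- Cramer's rule for barycentric coordinates. -/
lemma signedArea_combination {A B C : ℂ} {x y w : ℝ} (h : x + y + w = 1) :
    signedArea (x • A + y • B + w • C) B C = x * signedArea A B C := by
  obtain rfl : w = 1 - x - y := by linarith
  simp [signedArea]; ring

lemma signedArea_combination₂ {A B C : ℂ} {x y w : ℝ} (h : x + y + w = 1) :
    signedArea (x • A + y • B + w • C) C A = y * signedArea A B C := by
  obtain rfl : w = 1 - x - y := by linarith
  simp [signedArea]; ring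

lemma signedArea_combination₃ {A B C : ℂ} {x y w : ℝ} (h : x + y + w = 1) :
    signedArea (x • A + y • B + w • C) A B = w * signedArea A B C := by
  obtain rfl : w = 1 - x - y := by linarith
  simp [signedArea]; ring

/-- Barycentric coordinates with respect to a nondegenerate triangle are unique. -/
lemma barycentric_unique {A B C : ℂ} (hA : signedArea A B C ≠ 0) {x y w x' y' w' : ℝ}
    (h : x + y + w = 1) (h' : x' + y' + w' = 1)
    (he : x • A + y • B + w • C = x' • A + y' • B + w' • C) : x = x' ∧ y = y' ∧ w = w' := by
  have h1 := signedArea_combination (A := A) (B := B) (C := C) h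
  have h2 := signedArea_combination₂ (A := A) (B := B) (C := C) h
  rw [he, signedArea_combination h'] at h1
  rw [he, signedArea_combination₂ h'] at h2
  have e1 := mul_right_cancel₀ hA h1
  have e2 := mul_right_cancel₀ hA h2
  exact ⟨e1.symm, e2.symm, by linarith⟩

lemma affineIndependent_of_signedArea_ne_zero {A B C : ℂ} (h : signedArea A B C ≠ 0) :
    AffineIndependent ℝ ![A, B, C] := by
  rw [affineIndependent_iff_not_collinear_set]
  intro hc
  obtain ⟨v, hv⟩ := (collinear_iff_of_mem (p₀ := A) (by simp)).1 hc
  obtain ⟨r, hr⟩ := hv B (by simp)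
  obtain ⟨s, hs⟩ := hv C (by simp)
  refine h ?_
  subst hr hs
  simp [signedArea]; ring

/-- The affine basis formed by the vertices of a nondegenerate triangle. -/
noncomputable def triangleBasis {A B C : ℂ} (h : signedArea A B C ≠ 0) :
    AffineBasis (Fin 3) ℝ ℂ :=
  ⟨![A, B, C], affineIndependent_of_signedArea_ne_zero h, by
    rw [(affineIndependent_of_signedArea_ne_zero h).affineSpan_eq_top_iff_card_eq_finrank_add_one]
    simp [Complex.finrank_real_complex]⟩

lemma triangleBasis_spec {A B C : ℂ} (h : signedArea A B C ≠ 0) (z : ℂ) :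
    (triangleBasis h).coord 0 z + (triangleBasis h).coord 1 z + (triangleBasis h).coord 2 z = 1 ∧
      z = (triangleBasis h).coord 0 z • A + (triangleBasis h).coord 1 z • B +
        (triangleBasis h).coord 2 z • C := by
  constructor
  · rw [← (triangleBasis h).sum_coord_apply_eq_one z, Fin.sum_univ_three]
  · have := (triangleBasis h).linear_combination_coord_eq_self z
    rw [Fin.sum_univ_three] at this
    exact this.symm

lemma range_triangleBasis {A B C : ℂ} (h : signedArea A B C ≠ 0) :
    range (triangleBasis h) = {A, B, C} := by
  change range ![A, B, C] = _
  simp [Matrix.range_cons, Matrix.range_empty, union_comm]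
  ext; simp; tauto

lemma coord_triangleBasis {A B C : ℂ} (h : signedArea A B C ≠ 0) {x y w : ℝ}
    (hs : x + y + w = 1) :
    (triangleBasis h).coord 0 (x • A + y • B + w • C) = x ∧
    (triangleBasis h).coord 1 (x • A + y • B + w • C) = y ∧
    (triangleBasis h).coord 2 (x • A + y • B + w • C) = w := by
  obtain ⟨h1, h2⟩ := triangleBasis_spec h (x • A + y • B + w • C)
  exact barycentric_unique h h1 hs h2.symm

lemma mem_interior_triangle {A B C : ℂ} (h : signedArea A B C ≠ 0) {z : ℂ} :
    z ∈ interior (convexHull ℝ {A, B, C}) ↔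
      ∃ x y w : ℝ, 0 < x ∧ 0 < y ∧ 0 < w ∧ x + y + w = 1 ∧ z = x • A + y • B + w • C := by
  rw [← range_triangleBasis h, AffineBasis.interior_convexHull, mem_ofPred_eq]
  constructor
  · intro hz
    obtain ⟨h1, h2⟩ := triangleBasis_spec h z
    exact ⟨_, _, _, hz 0, hz 1, hz 2, h1, h2⟩
  · rintro ⟨x, y, w, hx, hy, hw, hs, rfl⟩ i
    obtain ⟨h0, h1, h2⟩ := coord_triangleBasis h hs
    fin_cases i <;> simp_all

lemma mem_triangle {A B C : ℂ} (h : signedArea A B C ≠ 0) {z : ℂ} :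
    z ∈ convexHull ℝ {A, B, C} ↔
      ∃ x y w : ℝ, 0 ≤ x ∧ 0 ≤ y ∧ 0 ≤ w ∧ x + y + w = 1 ∧ z = x • A + y • B + w • C := by
  rw [← range_triangleBasis h, AffineBasis.convexHull_eq_nonneg_coord, mem_ofPred_eq]
  constructor
  · intro hz
    obtain ⟨h1, h2⟩ := triangleBasis_spec h z
    exact ⟨_, _, _, hz 0, hz 1, hz 2, h1, h2⟩
  · rintro ⟨x, y, w, hx, hy, hw, hs, rfl⟩ i
    obtain ⟨h0, h1, h2⟩ := coord_triangleBasis h hs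
    fin_cases i <;> simp_all

lemma mem_openSegment_iff {A B z : ℂ} :
    z ∈ openSegment ℝ A B ↔ ∃ x y : ℝ, 0 < x ∧ 0 < y ∧ x + y = 1 ∧ z = x • A + y • B := by
  simp only [openSegment, mem_ofPred_eq]
  constructor
  · rintro ⟨x, y, hx, hy, hs, rfl⟩; exact ⟨x, y, hx, hy, hs, rfl⟩
  · rintro ⟨x, y, hx, hy, hs, rfl⟩; exact ⟨x, y, hx, hy, hs, rfl⟩

lemma triple_rotate (A B C : ℂ) : ({B, C, A} : Set ℂ) = {A, B, C} := by
  ext; simp; tauto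

lemma isClosed_triangle (A B C : ℂ) : IsClosed (convexHull ℝ ({A, B, C} : Set ℂ)) :=
  (Set.toFinite _).isClosed_convexHull ℝ

lemma nonempty_interior_triangle {A B C : ℂ} (h : signedArea A B C ≠ 0) :
    (interior (convexHull ℝ {A, B, C})).Nonempty :=
  ⟨_, (mem_interior_triangle h).2
    ⟨1 / 3, 1 / 3, 1 / 3, by norm_num, by norm_num, by norm_num, by norm_num, rfl⟩⟩

/-- The frontier of a triangle without the vertices is the union of the open sides. -/
lemma mem_frontier_triangle_diff {A B C : ℂ} (h : signedArea A B C ≠ 0) {z : ℂ} :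
    z ∈ frontier (convexHull ℝ {A, B, C}) \ {A, B, C} ↔
      z ∈ openSegment ℝ A B ∨ z ∈ openSegment ℝ B C ∨ z ∈ openSegment ℝ C A := by
  rw [(isClosed_triangle A B C).frontier_eq]
  simp only [mem_openSegment_iff]
  constructor
  · rintro ⟨⟨h1, h2⟩, h3⟩
    obtain ⟨x, y, w, hx, hy, hw, hs, rfl⟩ := (mem_triangle h).1 h1
    simp only [mem_insert_iff, mem_singleton_iff, not_or] at h3
    rcases hx.eq_or_lt with rfl | hx
    · rcases hy.eq_or_lt with rfl | hy
      · obtain rfl : w = 1 := by linarith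
        simp at h3
      · rcases hw.eq_or_lt with rfl | hw
        · obtain rfl : y = 1 := by linarith
          simp at h3
        · exact Or.inr (Or.inl ⟨y, w, hy, hw, by linarith, by simp⟩)
    · rcases hy.eq_or_lt with rfl | hy
      · rcases hw.eq_or_lt with rfl | hw
        · obtain rfl : x = 1 := by linarith
          simp at h3
        · exact Or.inr (Or.inr ⟨w, x, hw, hx, by linarith, by simp [add_comm]⟩)
      · rcases hw.eq_or_lt with rfl | hw
        · exact Or.inl ⟨x, y, hx, hy, by linarith, by simp⟩
        · exact absurd ((mem_interior_triangle h).2 ⟨x, y, w, hx, hy, hw, hs, rfl⟩) h2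
  · -- At most one barycentric coordinate of a point of an open side vanishes.
    have key : ∀ x y w : ℝ, 0 ≤ x → 0 ≤ y → 0 ≤ w → x + y + w = 1 →
        (x = 0 ∧ 0 < y ∧ 0 < w ∨ y = 0 ∧ 0 < x ∧ 0 < w ∨ w = 0 ∧ 0 < x ∧ 0 < y) →
        (x • A + y • B + w • C ∈ convexHull ℝ {A, B, C} ∧
          x • A + y • B + w • C ∉ interior (convexHull ℝ {A, B, C})) ∧
        x • A + y • B + w • C ∉ ({A, B, C} : Set ℂ) := by
      intro x y w hx hy hw hs hzero
      refine ⟨⟨(mem_triangle h).2 ⟨x, y, w, hx, hy, hw, hs, rfl⟩, ?_⟩, ?_⟩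
      · intro hi
        obtain ⟨x', y', w', hx', hy', hw', hs', he⟩ := (mem_interior_triangle h).1 hi
        obtain ⟨rfl, rfl, rfl⟩ := barycentric_unique h hs hs' he
        rcases hzero with h | h | h <;> linarith [h.1]
      · simp only [mem_insert_iff, mem_singleton_iff, not_or]
        refine ⟨fun he => ?_, fun he => ?_, fun he => ?_⟩
        · obtain ⟨rfl, rfl, rfl⟩ := barycentric_unique (x' := 1) (y' := 0) (w' := 0) h hs
            (by norm_num) (by simpa using he)
          norm_num at hzero
        · obtain ⟨rfl, rfl, rfl⟩ := barycentric_unique (x' := 0) (y' := 1) (w' := 0) h hs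
            (by norm_num) (by simpa using he)
          norm_num at hzero
        · obtain ⟨rfl, rfl, rfl⟩ := barycentric_unique (x' := 0) (y' := 0) (w' := 1) h hs
            (by norm_num) (by simpa using he)
          norm_num at hzero
    rintro (⟨x, y, hx, hy, hs, rfl⟩ | ⟨y, w, hy, hw, hs, rfl⟩ | ⟨w, x, hw, hx, hs, rfl⟩)
    · simpa using key x y 0 hx.le hy.le le_rfl (by linarith) (by simp [hx, hy])
    · simpa using key 0 y w le_rfl hy.le hw.le (by linarith) (by simp [hy, hw])
    · simpa [add_comm] using key x 0 w hx.le le_rfl hw.le (by linarith) (by simp [hw, hx])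

lemma vertex_notMem_interior_triangle {A B C : ℂ} (h : signedArea A B C ≠ 0) :
    A ∉ interior (convexHull ℝ {A, B, C}) := by
  intro hi
  obtain ⟨x, y, w, hx, hy, hw, hs, he⟩ := (mem_interior_triangle h).1 hi
  have := barycentric_unique (x := 1) (y := 0) (w := 0) h (by norm_num) hs (by simpa using he)
  linarith [this.2.1]

lemma vertices_subset_frontier_triangle {A B C : ℂ} (h : signedArea A B C ≠ 0) :
    ({A, B, C} : Set ℂ) ⊆ frontier (convexHull ℝ {A, B, C}) := by
  intro z hz
  rw [(isClosed_triangle A B C).frontier_eq]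
  refine ⟨subset_convexHull _ _ hz, ?_⟩
  rcases hz with rfl | rfl | rfl
  · exact vertex_notMem_interior_triangle h
  · rw [← triple_rotate]
    exact vertex_notMem_interior_triangle (by rwa [signedArea_rotate])
  · rw [← triple_rotate, ← triple_rotate]
    exact vertex_notMem_interior_triangle (by rwa [signedArea_rotate, signedArea_rotate])

/-- A preconnected relatively clopen subset is a connected component. -/
lemma connectedComponentIn_eq_of_separated {X : Type*} [TopologicalSpace X] {s K U V : Set X}
    {x : X} (hx : x ∈ K) (hKs : K ⊆ s) (hK : IsPreconnected K) (hU : IsOpen U) (hV : IsOpen V)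
    (hsUV : s ⊆ U ∪ V) (hdisj : s ∩ (U ∩ V) = ∅) (hKU : K ⊆ U) (hUK : s ∩ U ⊆ K) :
    connectedComponentIn s x = K := by
  refine Subset.antisymm (fun y hy => ?_) (hK.subset_connectedComponentIn hx hKs)
  have hss := connectedComponentIn_subset s x
  refine hUK ⟨hss hy, ?_⟩
  by_contra hyU
  have hyV := (hsUV (hss hy)).resolve_left hyU
  obtain ⟨z, hz, hzUV⟩ := isPreconnected_connectedComponentIn U V hU hV (hss.trans hsUV)
    ⟨x, mem_connectedComponentIn (hKs hx), hKU hx⟩ ⟨y, hy, hyV⟩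
  exact (hdisj ▸ (⟨hss hz, hzUV⟩ : z ∈ s ∩ (U ∩ V)) : z ∈ (∅ : Set X))

lemma connectedComponentIn_frontier_triangle {A B C : ℂ} (h : signedArea A B C ≠ 0) {z : ℂ}
    (hz : z ∈ openSegment ℝ A B) :
    connectedComponentIn (frontier (convexHull ℝ {A, B, C}) \ {A, B, C}) z =
      openSegment ℝ A B := by
  have hcontA : Continuous fun z => signedArea z B C / signedArea A B C :=
    (continuous_signedArea B C).div_const _
  have hcontB : Continuous fun z => signedArea z C A / signedArea A B C :=
    (continuous_signedArea C A).div_const _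
  have hcontC : Continuous fun z => signedArea z A B / signedArea A B C :=
    (continuous_signedArea A B).div_const _
  have hcoord : ∀ x y w : ℝ, x + y + w = 1 → ∀ z, z = x • A + y • B + w • C →
      signedArea z B C / signedArea A B C = x ∧ signedArea z C A / signedArea A B C = y ∧
      signedArea z A B / signedArea A B C = w := by
    rintro x y w hs z rfl
    rw [signedArea_combination hs, signedArea_combination₂ hs, signedArea_combination₃ hs]
    simp [h]
  have hAB : ∀ z ∈ openSegment ℝ A B, 0 < signedArea z B C / signedArea A B C ∧
      0 < signedArea z C A / signedArea A B C ∧ signedArea z A B / signedArea A B C = 0 := by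
    intro z hz
    obtain ⟨x, y, hx, hy, hs, he⟩ := mem_openSegment_iff.1 hz
    obtain ⟨h1, h2, h3⟩ := hcoord x y 0 (by linarith) z (by simpa using he)
    rw [h1, h2, h3]
    exact ⟨hx, hy, rfl⟩
  have hBC : ∀ z ∈ openSegment ℝ B C, signedArea z B C / signedArea A B C = 0 ∧
      0 < signedArea z A B / signedArea A B C := by
    intro z hz
    obtain ⟨x, y, hx, hy, hs, he⟩ := mem_openSegment_iff.1 hz
    obtain ⟨h1, h2, h3⟩ := hcoord 0 x y (by linarith) z (by simpa using he)
    rw [h1, h3]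
    exact ⟨rfl, hy⟩
  have hCA : ∀ z ∈ openSegment ℝ C A, signedArea z C A / signedArea A B C = 0 ∧
      0 < signedArea z A B / signedArea A B C := by
    intro z hz
    obtain ⟨x, y, hx, hy, hs, he⟩ := mem_openSegment_iff.1 hz
    obtain ⟨h1, h2, h3⟩ := hcoord y 0 x (by linarith) z (by simpa [add_comm] using he)
    rw [h2, h3]
    exact ⟨rfl, hx⟩
  refine connectedComponentIn_eq_of_separated
    (U := {z | 0 < signedArea z B C / signedArea A B C} ∩
      {z | 0 < signedArea z C A / signedArea A B C})
    (V := {z | 0 < signedArea z A B / signedArea A B C}) hz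
    (fun z hz => (mem_frontier_triangle_diff h).2 (Or.inl hz))
    (convex_openSegment A B).isPreconnected
    ((isOpen_lt continuous_const hcontA).inter (isOpen_lt continuous_const hcontB))
    (isOpen_lt continuous_const hcontC) ?_ ?_ (fun z hz => ⟨(hAB z hz).1, (hAB z hz).2.1⟩) ?_
  · intro z hz
    rcases (mem_frontier_triangle_diff h).1 hz with h1 | h1 | h1
    · exact Or.inl ⟨(hAB z h1).1, (hAB z h1).2.1⟩
    · exact Or.inr (hBC z h1).2
    · exact Or.inr (hCA z h1).2
  · ext z
    simp only [mem_inter_iff, mem_empty_iff_false, iff_false, not_and, mem_ofPred_eq]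
    intro hz hU
    rcases (mem_frontier_triangle_diff h).1 hz with h1 | h1 | h1
    · exact (hAB z h1).2.2.not_gt
    · exact absurd (hBC z h1).1 hU.1.ne'
    · exact absurd (hCA z h1).1 hU.2.ne'
  · rintro z ⟨hz, hU⟩
    rcases (mem_frontier_triangle_diff h).1 hz with h1 | h1 | h1
    · exact h1
    · exact absurd (hBC z h1).1 hU.1.ne'
    · exact absurd (hCA z h1).1 hU.2.ne'

/-! ### Triangulations of planar sets by straight segments -/

lemma image_val_preimage {F S : Set ℂ} (h : S ⊆ F) :
    Subtype.val '' ((↑) ⁻¹' S : Set F) = S := by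
  rw [Subtype.image_preimage_coe, inter_eq_right.2 h]

/-- An open segment whose endpoints are missing from `F` and tend to ends of `F` is an arc. -/
lemma exists_isArc_openSegment {F : Set ℂ} {a b : ℂ} (hab : a ≠ b) (hF : openSegment ℝ a b ⊆ F)
    (ha : a ∉ F) (hb : b ∉ F)
    (hea : ∃ e : EndSeq F, ∀ i, e.nbhd i ∈ comap Subtype.val (𝓝 a))
    (heb : ∃ e : EndSeq F, ∀ i, e.nbhd i ∈ comap Subtype.val (𝓝 b)) :
    ∃ α : ℝ → F, IsArc α ∧ Subtype.val '' range α = openSegment ℝ a b := by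
  let g : ℝ → ℂ := fun t => AffineMap.lineMap a b t
  have hgc : Continuous g := AffineMap.lineMap_continuous
  have himg : openSegment ℝ a b = g '' Ioo 0 1 := openSegment_eq_image_lineMap ℝ a b
  have hgF : ∀ t, g (Real.sigmoid t) ∈ F := fun t => hF <| himg ▸
    ⟨_, ⟨Real.sigmoid_pos t, Real.sigmoid_lt_one t⟩, rfl⟩
  let α : ℝ → F := fun t => ⟨g (Real.sigmoid t), hgF t⟩
  have hcont : Continuous α := (hgc.comp continuous_sigmoid).subtype_mk _
  have hrange : Subtype.val '' range α = openSegment ℝ a b := by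
    rw [himg, ← Real.range_sigmoid, ← range_comp, ← range_comp]
    rfl
  have hembσ : IsEmbedding Real.sigmoid :=
    IsEmbedding.subtypeVal.comp isEmbedding_sigmoid
  have hembg : IsEmbedding g := by
    exact (antilipschitzWith_lineMap hab).isEmbedding hgc
  have hemb : IsEmbedding α :=
    IsEmbedding.of_comp hcont continuous_subtype_val (hembg.comp hembσ)
  have hclosed : IsClosed (range α) := by
    have : range α = Subtype.val ⁻¹' segment ℝ a b := by
      ext x
      have h1 : x ∈ range α ↔ (x : ℂ) ∈ openSegment ℝ a b := by
        rw [← hrange, Subtype.val_injective.mem_set_image]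
      rw [h1, mem_preimage]
      refine ⟨fun h => openSegment_subset_segment ℝ a b h, fun h => ?_⟩
      rcases (segment_eq_image_lineMap ℝ a b ▸ h : (x : ℂ) ∈ _) with ⟨t, ht, hx⟩
      refine mem_openSegment_of_ne_left_right ?_ ?_ h
      · rintro rfl; exact ha x.2
      · rintro rfl; exact hb x.2
    rw [this]
    refine IsClosed.preimage continuous_subtype_val ?_
    rw [segment_eq_image_lineMap]
    exact (isCompact_Icc.image hgc).isClosed
  refine ⟨α, ⟨(IsClosedEmbedding.mk hemb hclosed).isProperMap, hemb, ?_, ?_⟩, hrange⟩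
  · obtain ⟨e, he⟩ := heb
    refine ⟨e, fun i => ?_⟩
    have : Tendsto α atTop (comap Subtype.val (𝓝 b)) := by
      refine tendsto_comap_iff.2 ?_
      have h1 : g 1 = b := by simp [g]
      exact h1 ▸ (hgc.tendsto 1).comp Real.tendsto_sigmoid_atTop
    exact this (he i)
  · obtain ⟨e, he⟩ := hea
    refine ⟨e, fun i => ?_⟩
    have : Tendsto α atBot (comap Subtype.val (𝓝 a)) := by
      refine tendsto_comap_iff.2 ?_
      have h1 : g 0 = a := by simp [g]
      exact h1 ▸ (hgc.tendsto 0).comp Real.tendsto_sigmoid_atBot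
    exact this (he i)

/-- A triangle without its vertices, closed in `F`, whose sides are arcs is a disk bounded by at
most three sides: a homeomorphism of the plane carries the triangle to the closed unit disk. -/
lemma isBoundedByAtMostThreeSides_triangle {F : Set ℂ} {A B C : ℂ} (h : signedArea A B C ≠ 0)
    (hF : convexHull ℝ {A, B, C} \ {A, B, C} ⊆ F) (hV : Disjoint {A, B, C} F) {μ : ℕ → ℝ → F}
    (hAB : ∃ i, Subtype.val '' range (μ i) = openSegment ℝ A B)
    (hBC : ∃ i, Subtype.val '' range (μ i) = openSegment ℝ B C)
    (hCA : ∃ i, Subtype.val '' range (μ i) = openSegment ℝ C A) :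
    IsBoundedByAtMostThreeSides μ ((↑) ⁻¹' interior (convexHull ℝ {A, B, C}) : Set F) := by
  classical
  set T := convexHull ℝ ({A, B, C} : Set ℂ) with hT
  have hTcl : IsClosed T := isClosed_triangle A B C
  obtain ⟨e, hint, hcl, hfr⟩ := exists_homeomorph_image_interior_closure_frontier_eq_unitBall
    (convex_convexHull ℝ ({A, B, C} : Set ℂ)) (nonempty_interior_triangle h)
    (isBounded_convexHull.2 (Set.toFinite _).isBounded)
  rw [← hT] at hint hcl hfr
  rw [hTcl.closure_eq] at hcl
  have hintF : interior T ⊆ F := fun z hz => hF ⟨interior_subset hz, fun hz' => by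
    have := vertices_subset_frontier_triangle h hz'
    rw [frontier] at this
    exact this.2 hz⟩
  obtain ⟨z₀, hz₀⟩ := nonempty_interior_triangle h
  let f : ℂ → F := fun z => if hz : e.symm z ∈ F then ⟨e.symm z, hz⟩ else ⟨z₀, hintF hz₀⟩
  have hf : ∀ z ∈ F, (f (e z) : ℂ) = z := fun z hz => by
    have : e.symm (e z) ∈ F := by rwa [e.symm_apply_apply]
    simp only [f, this, dif_pos]
    exact e.symm_apply_apply z
  have hbij : ∀ S ⊆ F, BijOn f (e '' S) ((↑) ⁻¹' S) := fun S hS => by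
    refine ⟨?_, ?_, ?_⟩
    · rintro _ ⟨z, hz, rfl⟩
      rw [mem_preimage, hf z (hS hz)]
      exact hz
    · rintro _ ⟨z, hz, rfl⟩ _ ⟨w, hw, rfl⟩ hzw
      have := congrArg Subtype.val hzw
      rw [hf z (hS hz), hf w (hS hw)] at this
      rw [this]
    · intro x hx
      exact ⟨e x, mem_image_of_mem e hx, Subtype.ext (hf x x.2)⟩
  have hW : (({e A, e B, e C} : Finset ℂ) : Set ℂ) = e '' {A, B, C} := by
    simp [image_insert_eq]
  refine ⟨{e A, e B, e C}, f, Finset.card_le_three, ?_, ?_, ?_, ?_⟩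
  · rw [hW, ← hfr]
    exact image_mono (vertices_subset_frontier_triangle h)
  · have hdom : closedBall (0 : ℂ) 1 \ (({e A, e B, e C} : Finset ℂ) : Set ℂ) =
        e '' (T \ {A, B, C}) := by
      rw [hW, ← hcl, image_sdiff e.injective]
    rw [hdom]
    set g := (e '' (T \ {A, B, C})).domRestrict f with hg
    have hgval : Subtype.val ∘ g = e.symm ∘ Subtype.val := by
      funext ⟨_, z, hz, rfl⟩
      change (f (e z) : ℂ) = e.symm (e z)
      rw [hf z (hF hz), e.symm_apply_apply]
    have hemb : IsEmbedding (Subtype.val ∘ g) := by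
      rw [hgval]
      exact e.symm.isEmbedding.comp IsEmbedding.subtypeVal
    have hgc : Continuous g := continuous_induced_rng.2 hemb.continuous
    refine (IsClosedEmbedding.mk (IsEmbedding.of_comp hgc continuous_subtype_val hemb)
      ?_).isProperMap
    have : range g = Subtype.val ⁻¹' T := by
      rw [hg, range_domRestrict, (hbij _ hF).image_eq]
      ext x
      simp only [mem_preimage, Set.mem_sdiff, and_iff_left_iff_imp]
      exact fun _ hx => disjoint_left.1 hV hx x.2
    rw [this]
    exact hTcl.preimage continuous_subtype_val
  · rw [← hint]
    exact hbij _ hintF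
  · have hdom : sphere (0 : ℂ) 1 \ (({e A, e B, e C} : Finset ℂ) : Set ℂ) =
        e '' (frontier T \ {A, B, C}) := by
      rw [hW, ← hfr, image_sdiff e.injective]
    rw [hdom]
    have hside : ∀ S : Set ℂ, S ⊆ frontier T \ {A, B, C} →
        ∀ i, Subtype.val '' range (μ i) = S → BijOn f (e '' S) (range (μ i)) := fun S hS i hi => by
      have hSF : S ⊆ F := fun z hz => hF ⟨hTcl.frontier_subset (hS hz).1, (hS hz).2⟩
      have : range (μ i) = (↑) ⁻¹' S := by
        rw [← hi, preimage_image_eq _ Subtype.val_injective]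
      rw [this]
      exact hbij S hSF
    rintro _ ⟨z, hz, rfl⟩
    rw [← e.image_connectedComponentIn hz]
    rcases (mem_frontier_triangle_diff h).1 hz with h1 | h1 | h1
    · obtain ⟨i, hi⟩ := hAB
      refine ⟨i, ?_⟩
      have hcomp := connectedComponentIn_frontier_triangle h h1
      rw [← hT] at hcomp
      rw [hcomp]
      exact hside _ (hcomp ▸ connectedComponentIn_subset _ _) i hi
    · obtain ⟨i, hi⟩ := hBC
      refine ⟨i, ?_⟩
      have hcomp := connectedComponentIn_frontier_triangle
        (by rwa [signedArea_rotate] : signedArea B C A ≠ 0) h1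
      rw [triple_rotate, ← hT] at hcomp
      rw [hcomp]
      exact hside _ (hcomp ▸ connectedComponentIn_subset _ _) i hi
    · obtain ⟨i, hi⟩ := hCA
      refine ⟨i, ?_⟩
      have hcomp := connectedComponentIn_frontier_triangle
        (by rwa [signedArea_rotate, signedArea_rotate] : signedArea C A B ≠ 0) h1
      rw [triple_rotate, triple_rotate, ← hT] at hcomp
      rw [hcomp]
      exact hside _ (hcomp ▸ connectedComponentIn_subset _ _) i hi

/-- A family `𝒮` of open segments and a family `𝒦` of open triangles that decompose the planar
set `F` in the combinatorial pattern of an ideal triangulation: the endpoints of the segments are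
missing from `F` and tend to ends of `F`, and the sides of each triangle belong to `𝒮`. -/
structure IsStraightTriangulation (F : Set ℂ) (𝒮 𝒦 : Set (Set ℂ)) : Prop where
  infinite : 𝒮.Infinite
  countable : 𝒮.Countable
  segment : ∀ S ∈ 𝒮, ∃ a b : ℂ, a ≠ b ∧ S = openSegment ℝ a b ∧ a ∉ F ∧ b ∉ F ∧
    (∃ e : EndSeq F, ∀ i, e.nbhd i ∈ comap Subtype.val (𝓝 a)) ∧
    (∃ e : EndSeq F, ∀ i, e.nbhd i ∈ comap Subtype.val (𝓝 b))
  disjoint : ∀ S ∈ 𝒮, ∀ S' ∈ 𝒮, S ≠ S' → Disjoint S S'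
  locallyFinite : ∀ x ∈ F, ∃ U ∈ 𝓝 x, {S ∈ 𝒮 | (S ∩ U).Nonempty}.Finite
  triangle : ∀ K ∈ 𝒦, ∃ A B C : ℂ, signedArea A B C ≠ 0 ∧
    K = interior (convexHull ℝ {A, B, C}) ∧ A ∉ F ∧ B ∉ F ∧ C ∉ F ∧
    openSegment ℝ A B ∈ 𝒮 ∧ openSegment ℝ B C ∈ 𝒮 ∧ openSegment ℝ C A ∈ 𝒮
  triangle_disjoint : ∀ K ∈ 𝒦, ∀ K' ∈ 𝒦, K ≠ K' → Disjoint K K'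
  triangle_segment_disjoint : ∀ K ∈ 𝒦, ∀ S ∈ 𝒮, Disjoint K S
  cover : F = ⋃₀ 𝒮 ∪ ⋃₀ 𝒦

/-- The segments of a straight triangulation, parametrized as arcs, form an ideal triangulation. -/
theorem IsStraightTriangulation.exists_isIdealTriangulation {F : Set ℂ} {𝒮 𝒦 : Set (Set ℂ)}
    (H : IsStraightTriangulation F 𝒮 𝒦) :
    ∃ μ : ℕ → ℝ → F, IsIdealTriangulation μ ∧
      (range fun i => Subtype.val '' range (μ i)) = 𝒮 := by
  have hSF : ∀ S ∈ 𝒮, S ⊆ F := fun S hS => by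
    rw [H.cover]; exact (subset_sUnion_of_mem hS).trans subset_union_left
  have hKF : ∀ K ∈ 𝒦, K ⊆ F := fun K hK => by
    rw [H.cover]; exact (subset_sUnion_of_mem hK).trans subset_union_right
  have : Countable 𝒮 := H.countable
  have : Infinite 𝒮 := H.infinite.to_subtype
  obtain ⟨⟨φ⟩⟩ : Nonempty (Nonempty (ℕ ≃ 𝒮)) := ⟨nonempty_equiv_of_countable⟩
  have harc : ∀ i, ∃ α : ℝ → F, IsArc α ∧ Subtype.val '' range α = φ i := fun i => by
    obtain ⟨a, b, hab, hS, ha, hb, hea, heb⟩ := H.segment _ (φ i).2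
    have := hSF _ (φ i).2
    rw [hS] at this ⊢
    exact exists_isArc_openSegment hab this ha hb hea heb
  choose μ hμ hμφ using harc
  have hrange : ∀ i, range (μ i) = (↑) ⁻¹' (φ i : Set ℂ) := fun i => by
    rw [← hμφ, preimage_image_eq _ Subtype.val_injective]
  have hunion : (⋃ i, range (μ i)) = (↑) ⁻¹' ⋃₀ 𝒮 := by
    simp only [hrange, sUnion_eq_iUnion, preimage_iUnion]
    exact φ.surjective.iUnion_comp fun S : 𝒮 => ((↑) ⁻¹' (S : Set ℂ) : Set F)
  have hcompl : ∀ x ∈ (⋃ i, range (μ i))ᶜ, ∃ K ∈ 𝒦, (x : ℂ) ∈ K := fun x hx => by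
    rw [hunion] at hx
    exact ((H.cover ▸ x.2 : (x : ℂ) ∈ ⋃₀ 𝒮 ∪ ⋃₀ 𝒦).resolve_left hx)
  have hKopen : ∀ K ∈ 𝒦, IsOpen K := fun K hK => by
    obtain ⟨A, B, C, -, rfl, -⟩ := H.triangle K hK
    exact isOpen_interior
  have hcomp : ∀ K ∈ 𝒦, ∀ x : F, (x : ℂ) ∈ K →
      connectedComponentIn (⋃ i, range (μ i))ᶜ x = (↑) ⁻¹' K := fun K hK x hx => by
    refine connectedComponentIn_eq_of_separated (U := (↑) ⁻¹' K)
      (V := (↑) ⁻¹' ⋃₀ (𝒦 \ {K})) hx ?_ ?_ ((hKopen K hK).preimage continuous_subtype_val)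
      ((isOpen_sUnion fun K' hK' => hKopen K' hK'.1).preimage continuous_subtype_val) ?_ ?_
      Subset.rfl inter_subset_right
    · intro y hy hy'
      rw [hunion] at hy'
      obtain ⟨S, hS, hyS⟩ := hy'
      exact disjoint_left.1 (H.triangle_segment_disjoint K hK S hS) hy hyS
    · rw [← IsInducing.subtypeVal.isPreconnected_image, image_val_preimage (hKF K hK)]
      obtain ⟨A, B, C, -, rfl, -⟩ := H.triangle K hK
      exact (convex_convexHull ℝ _).interior.isPreconnected
    · intro y hy
      obtain ⟨K', hK', hyK'⟩ := hcompl y hy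
      by_cases hKK : K' = K
      · exact Or.inl (hKK ▸ hyK')
      · exact Or.inr ⟨K', ⟨hK', hKK⟩, hyK'⟩
    · ext y
      simp only [mem_inter_iff, mem_empty_iff_false, iff_false]
      rintro ⟨-, hy, K', ⟨hK', hne⟩, hy'⟩
      exact disjoint_left.1 (H.triangle_disjoint K hK K' hK' fun h => hne h.symm) hy hy'
  refine ⟨μ, ⟨hμ, ?_, ?_, ?_, ?_, ?_⟩, ?_⟩
  · intro i j hij
    rw [hrange, hrange]
    refine Disjoint.preimage _ (H.disjoint _ (φ i).2 _ (φ j).2 fun h => hij ?_)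
    exact φ.injective (Subtype.ext h)
  · intro x
    obtain ⟨U, hU, hfin⟩ := H.locallyFinite x x.2
    refine ⟨(↑) ⁻¹' U, continuous_subtype_val.continuousAt.preimage_mem_nhds hU, ?_⟩
    refine Finite.of_finite_image (f := fun i => (φ i : Set ℂ)) (hfin.subset ?_)
      (fun i _ j _ h => φ.injective (Subtype.ext h))
    rintro _ ⟨i, ⟨y, hy, hyU⟩, rfl⟩
    have hy' : y ∈ range (μ i) := hy
    rw [hrange] at hy'
    exact ⟨(φ i).2, y, hy', hyU⟩
  · intro x hx
    obtain ⟨K, hK, hxK⟩ := hcompl x hx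
    rw [hcomp K hK x hxK]
    exact (hKopen K hK).preimage continuous_subtype_val
  · intro x hx
    obtain ⟨K, hK, hxK⟩ := hcompl x hx
    rw [hcomp K hK x hxK]
    obtain ⟨A, B, C, hA, hKeq, -⟩ := H.triangle K hK
    obtain ⟨e, hint, -, -⟩ := exists_homeomorph_image_interior_closure_frontier_eq_unitBall
      (convex_convexHull ℝ ({A, B, C} : Set ℂ)) (nonempty_interior_triangle hA)
      (isBounded_convexHull.2 (Set.toFinite _).isBounded)
    have e1 : ((↑) ⁻¹' K : Set F) ≃ₜ K :=
      (IsEmbedding.subtypeVal.homeomorphImage ((↑) ⁻¹' K : Set F)).trans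
        (Homeomorph.setCongr (image_val_preimage (hKF K hK)))
    exact ⟨e1.trans ((e.image K).trans (Homeomorph.setCongr (by rw [hKeq, hint])))⟩
  · intro x hx
    obtain ⟨K, hK, hxK⟩ := hcompl x hx
    rw [hcomp K hK x hxK]
    obtain ⟨A, B, C, hA, rfl, hAF, hBF, hCF, hAB, hBC, hCA⟩ := H.triangle K hK
    have hside : ∀ S ∈ 𝒮, ∃ i, Subtype.val '' range (μ i) = S := fun S hS =>
      ⟨φ.symm ⟨S, hS⟩, by rw [hμφ]; simp⟩
    refine isBoundedByAtMostThreeSides_triangle hA ?_ ?_ (hside _ hAB) (hside _ hBC) (hside _ hCA)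
    · rintro z ⟨hz, hzV⟩
      by_cases hzi : z ∈ interior (convexHull ℝ {A, B, C})
      · exact hKF _ hK hzi
      · have hfr : z ∈ frontier (convexHull ℝ {A, B, C}) := by
          rw [(isClosed_triangle A B C).frontier_eq]
          exact ⟨hz, hzi⟩
        rcases (mem_frontier_triangle_diff hA).1 ⟨hfr, hzV⟩ with h | h | h
        · exact hSF _ hAB h
        · exact hSF _ hBC h
        · exact hSF _ hCA h
    · rw [disjoint_left]
      rintro z (rfl | rfl | rfl) <;> assumption
  · simp only [hμφ]
    rw [← Function.comp_def (fun S : 𝒮 => (S : Set ℂ)) φ, φ.surjective.range_comp]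
    exact Subtype.range_coe

/-! ### Transport along homeomorphisms -/

/-- The image of an end under a homeomorphism. -/
def EndSeq.map {X Y : Type*} [TopologicalSpace X] [TopologicalSpace Y] (e : X ≃ₜ Y)
    (s : EndSeq X) : EndSeq Y where
  nbhd i := e '' s.nbhd i
  isOpen i := e.isOpen_image.2 (s.isOpen i)
  isConnected i := (s.isConnected i).image e e.continuous.continuousOn
  isCompact_frontier i := by
    rw [← e.image_frontier]
    exact (s.isCompact_frontier i).image e.continuous
  antitone _ _ hij := image_mono (s.antitone hij)
  leaves K hK := by
    obtain ⟨i, hi⟩ := s.leaves (e ⁻¹' K) (e.isCompact_preimage.2 hK)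
    refine ⟨i, ?_⟩
    rw [disjoint_left] at hi ⊢
    rintro _ ⟨x, hx, rfl⟩
    exact hi hx

/-- Ideal triangulations are carried to ideal triangulations by homeomorphisms. -/
theorem IsIdealTriangulation.comp_homeomorph {X Y : Type*} [TopologicalSpace X]
    [TopologicalSpace Y] (e : X ≃ₜ Y) {μ : ℕ → ℝ → X} (h : IsIdealTriangulation μ) :
    IsIdealTriangulation fun i => e ∘ μ i := by
  have hcompl : (⋃ i, range (e ∘ μ i))ᶜ = e '' (⋃ i, range (μ i))ᶜ := by
    simp only [range_comp, ← image_iUnion, image_compl_eq e.bijective]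
  have hcc : ∀ x ∈ (⋃ i, range (μ i))ᶜ,
      connectedComponentIn (⋃ i, range (e ∘ μ i))ᶜ (e x) =
        e '' connectedComponentIn (⋃ i, range (μ i))ᶜ x := fun x hx => by
    rw [hcompl, e.image_connectedComponentIn hx]
  refine ⟨fun i => ⟨?_, ?_, ?_, ?_⟩, ?_, ?_, ?_, ?_, ?_⟩
  · exact e.isProperMap.comp (h.arc i).proper
  · exact e.isEmbedding.comp (h.arc i).embedding
  · obtain ⟨s, hs⟩ := (h.arc i).end_pos
    exact ⟨s.map e, fun j => (hs j).mono fun t ht => mem_image_of_mem e ht⟩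
  · obtain ⟨s, hs⟩ := (h.arc i).end_neg
    exact ⟨s.map e, fun j => (hs j).mono fun t ht => mem_image_of_mem e ht⟩
  · intro i j hij
    rw [range_comp, range_comp, disjoint_image_iff e.injective]
    exact h.disjoint i j hij
  · intro y
    obtain ⟨U, hU, hfin⟩ := h.locallyFinite (e.symm y)
    refine ⟨e.symm ⁻¹' U, e.symm.continuous.continuousAt.preimage_mem_nhds hU, hfin.subset ?_⟩
    rintro i ⟨_, ⟨t, rfl⟩, ht⟩
    exact ⟨μ i t, mem_range_self t, by simpa using ht⟩
  · rw [hcompl]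
    rintro _ ⟨x, hx, rfl⟩
    rw [← hcompl, hcc x hx]
    exact e.isOpen_image.2 (h.isOpen_component x hx)
  · rw [hcompl]
    rintro _ ⟨x, hx, rfl⟩
    rw [← hcompl, hcc x hx]
    obtain ⟨g⟩ := h.disk x hx
    exact ⟨(e.image _).symm.trans g⟩
  · rw [hcompl]
    rintro _ ⟨x, hx, rfl⟩
    rw [← hcompl, hcc x hx]
    obtain ⟨W, f, hW, hWs, hprop, hbij, hsides⟩ := h.sides x hx
    refine ⟨W, e ∘ f, hW, hWs, e.isProperMap.comp hprop,
      (e.injective.injOn.bijOn_image).comp hbij, fun z hz => ?_⟩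
    obtain ⟨i, hi⟩ := hsides z hz
    exact ⟨i, by rw [range_comp]; exact (e.injective.injOn.bijOn_image).comp hi⟩

/-! ### Farey points and the determinant form -/

/-- The determinant of two integer vectors; Farey neighbours are those with determinant `± 1`. -/
def fdet (u v : ℤ × ℤ) : ℤ := u.1 * v.2 - u.2 * v.1

/-- The square of the Euclidean norm of an integer vector. -/
def nsq (u : ℤ × ℤ) : ℝ := (u.1 : ℝ) ^ 2 + (u.2 : ℝ) ^ 2

lemma fareyAdj_iff {u v : ℤ × ℤ} : FareyAdj u v ↔ |fdet u v| = 1 := Iff.rfl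

lemma FareyAdj.fdet_sq {u v : ℤ × ℤ} (h : FareyAdj u v) : fdet u v ^ 2 = 1 := by
  rw [← sq_abs, fareyAdj_iff.1 h, one_pow]

lemma FareyAdj.fdet_ne_zero {u v : ℤ × ℤ} (h : FareyAdj u v) : fdet u v ≠ 0 := by
  intro h0
  simpa [h0] using h.fdet_sq

lemma FareyAdj.symm {u v : ℤ × ℤ} (h : FareyAdj u v) : FareyAdj v u := by
  rw [fareyAdj_iff] at h ⊢
  rw [← h, ← abs_neg]
  congr 1
  simp only [fdet]; ring

lemma one_le_nsq {u : ℤ × ℤ} (h : u ≠ 0) : 1 ≤ nsq u := by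
  have : 1 ≤ u.1 ^ 2 + u.2 ^ 2 := by
    by_contra! hlt
    have h1 : u.1 = 0 := by nlinarith [sq_nonneg u.1, sq_nonneg u.2]
    have h2 : u.2 = 0 := by nlinarith [sq_nonneg u.1, sq_nonneg u.2]
    exact h (Prod.ext h1 h2)
  unfold nsq
  exact_mod_cast this

lemma FareyAdj.one_le_nsq {u v : ℤ × ℤ} (h : FareyAdj u v) : 1 ≤ nsq u := by
  refine Flute.one_le_nsq ?_
  rintro rfl
  exact h.fdet_ne_zero (by simp [fdet])

lemma FareyAdj.nsq_pos {u v : ℤ × ℤ} (h : FareyAdj u v) : 0 < nsq u :=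
  one_pos.trans_le h.one_le_nsq

lemma finite_nsq_le (M : ℝ) : {u : ℤ × ℤ | nsq u ≤ M}.Finite := by
  obtain ⟨N, hN⟩ := exists_nat_ge M
  refine ((finite_Icc (-(N : ℤ)) N).prod (finite_Icc (-(N : ℤ)) N)).subset ?_
  intro u hu
  have hu' : nsq u ≤ N := le_trans hu hN
  have h : u.1 ^ 2 + u.2 ^ 2 ≤ (N : ℤ) := by
    unfold nsq at hu'
    exact_mod_cast hu'
  have key : ∀ a b : ℤ, a ^ 2 + b ^ 2 ≤ (N : ℤ) → -(N : ℤ) ≤ a ∧ a ≤ N := by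
    intro a b hab
    have h1 := Int.le_self_sq a
    have h2 := Int.le_self_sq (-a)
    constructor <;> nlinarith [sq_nonneg b]
  exact ⟨key _ _ h, key _ u.1 (by linarith)⟩

lemma fareyPoint_re_im (u : ℤ × ℤ) :
    (fareyPoint u).re = ((u.1 : ℝ) ^ 2 - (u.2 : ℝ) ^ 2) / nsq u ∧
      (fareyPoint u).im = -2 * u.1 * u.2 / nsq u := by
  have hn : (u.1 : ℝ) * u.1 + u.2 * u.2 = nsq u := by unfold nsq; ring
  constructor
  · simp [fareyPoint, Complex.div_re, Complex.normSq_apply, hn]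
    ring
  · simp [fareyPoint, Complex.div_im, Complex.normSq_apply, hn]
    ring

lemma norm_sub_fareyPoint_sq {u v : ℤ × ℤ} (hu : 0 < nsq u) (hv : 0 < nsq v) :
    ‖fareyPoint u - fareyPoint v‖ ^ 2 * (nsq u * nsq v) = 4 * (fdet u v : ℝ) ^ 2 := by
  obtain ⟨h1, h2⟩ := fareyPoint_re_im u
  obtain ⟨h3, h4⟩ := fareyPoint_re_im v
  rw [← Complex.normSq_eq_norm_sq, Complex.normSq_apply, Complex.sub_re, Complex.sub_im, h1, h2,
    h3, h4]
  have hu' := hu.ne'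
  have hv' := hv.ne'
  field_simp
  simp only [nsq, fdet]
  push_cast
  ring

lemma norm_fareyPoint {u : ℤ × ℤ} (hu : 0 < nsq u) : ‖fareyPoint u‖ = 1 := by
  obtain ⟨h1, h2⟩ := fareyPoint_re_im u
  have : ‖fareyPoint u‖ ^ 2 = 1 := by
    rw [← Complex.normSq_eq_norm_sq, Complex.normSq_apply, h1, h2]
    have hu' := hu.ne'
    field_simp
    simp only [nsq]
    ring
  exact (sq_eq_sq₀ (norm_nonneg _) zero_le_one).1 (by rw [this, one_pow])

lemma fareyPoint_eq_iff {u v : ℤ × ℤ} (hu : 0 < nsq u) (hv : 0 < nsq v) :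
    fareyPoint u = fareyPoint v ↔ fdet u v = 0 := by
  have h := norm_sub_fareyPoint_sq hu hv
  constructor
  · intro he
    rw [he, sub_self, norm_zero] at h
    have : (fdet u v : ℝ) ^ 2 = 0 := by linarith
    exact_mod_cast pow_eq_zero_iff (two_ne_zero) |>.1 this
  · intro he
    rw [he] at h
    have h' : ‖fareyPoint u - fareyPoint v‖ ^ 2 = 0 := by
      have := (mul_pos hu hv).ne'
      simpa [this] using h
    exact sub_eq_zero.1 (norm_eq_zero.1 (pow_eq_zero_iff two_ne_zero |>.1 h'))

lemma FareyAdj.fareyPoint_ne {u v : ℤ × ℤ} (h : FareyAdj u v) : fareyPoint u ≠ fareyPoint v :=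
  fun he => h.fdet_ne_zero ((fareyPoint_eq_iff h.nsq_pos h.symm.nsq_pos).1 he)

lemma signedArea_fareyPoint {u v w : ℤ × ℤ} (hu : 0 < nsq u) (hv : 0 < nsq v) (hw : 0 < nsq w) :
    signedArea (fareyPoint u) (fareyPoint v) (fareyPoint w) * (nsq u * nsq v * nsq w) =
      4 * (fdet u v * fdet v w * fdet w u : ℤ) := by
  obtain ⟨h1, h2⟩ := fareyPoint_re_im u
  obtain ⟨h3, h4⟩ := fareyPoint_re_im v
  obtain ⟨h5, h6⟩ := fareyPoint_re_im w
  simp only [signedArea, Complex.sub_re, Complex.sub_im, h1, h2, h3, h4, h5, h6]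
  have hu' := hu.ne'
  have hv' := hv.ne'
  have hw' := hw.ne'
  field_simp
  simp only [nsq, fdet]
  push_cast
  ring

lemma signedArea_fareyPoint_ne_zero {u v w : ℤ × ℤ} (huv : FareyAdj u v) (hvw : FareyAdj v w)
    (hwu : FareyAdj w u) :
    signedArea (fareyPoint u) (fareyPoint v) (fareyPoint w) ≠ 0 := by
  intro h
  have := signedArea_fareyPoint huv.nsq_pos hvw.nsq_pos hwu.nsq_pos
  rw [h, zero_mul] at this
  have h0 : (fdet u v * fdet v w * fdet w u : ℤ) = 0 := by
    have : ((fdet u v * fdet v w * fdet w u : ℤ) : ℝ) = 0 := by linarith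
    exact_mod_cast this
  simp [huv.fdet_ne_zero, hvw.fdet_ne_zero, hwu.fdet_ne_zero] at h0

/-! ### Farey edges do not cross -/

/-- A real affine function vanishing on the line through the Farey points of `u` and `v`. A point
`z` of the disk is the positive definite symmetric matrix `M` of trace one with entries
`(1 + re z) / 2`, `-im z / 2`, `(1 - re z) / 2`, a Farey point of `x` being `x xᵀ / |x|²`, and
`chordForm u v z` is the polar form of the adjugate of `M`, evaluated at `u` and `v`. -/
noncomputable def chordForm (u v : ℤ × ℤ) (z : ℂ) : ℝ :=
  ((1 + z.re) * (u.2 * v.2) + z.im * (u.2 * v.1 + u.1 * v.2) + (1 - z.re) * (u.1 * v.1)) / 2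

lemma chordForm_fareyPoint (u v : ℤ × ℤ) {x : ℤ × ℤ} (hx : 0 < nsq x) :
    chordForm u v (fareyPoint x) = (fdet x u * fdet x v : ℤ) / nsq x := by
  obtain ⟨h1, h2⟩ := fareyPoint_re_im x
  have hx' := hx.ne'
  rw [chordForm, h1, h2]
  field_simp
  simp only [nsq, fdet]
  push_cast
  ring

lemma chordForm_combination (u v : ℤ × ℤ) {A B C : ℂ} {x y w : ℝ} (h : x + y + w = 1) :
    chordForm u v (x • A + y • B + w • C) =
      x * chordForm u v A + y * chordForm u v B + w * chordForm u v C := by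
  obtain rfl : w = 1 - x - y := by linarith
  simp [chordForm]; ring

/-- A Farey edge has both its endpoints on the same side of any other Farey edge: by the Plücker
relation the products of the first two and of the last two of the determinants
`[x u] [y v]`, `[x v] [y u]` are integers that differ by one. -/
lemma FareyAdj.not_cross {u v x y : ℤ × ℤ} (h : FareyAdj u v) (h' : FareyAdj x y) :
    0 ≤ (fdet x u * fdet x v) * (fdet y u * fdet y v) := by
  have hP : (fdet x u * fdet y v - fdet x v * fdet y u) ^ 2 = 1 := by
    have : fdet x u * fdet y v - fdet x v * fdet y u = fdet x y * fdet u v := by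
      simp only [fdet]; ring
    rw [this, mul_pow, h.fdet_sq, h'.fdet_sq, one_mul]
  have he : (fdet x u * fdet x v) * (fdet y u * fdet y v) =
    (fdet x u * fdet y v) * (fdet x v * fdet y u) := by ring
  rw [he]
  generalize fdet x u * fdet y v = P at *
  generalize fdet x v * fdet y u = Q at *
  rcases sq_eq_one_iff.1 hP with h | h
  · obtain rfl : P = Q + 1 := by linarith
    rcases le_or_gt 0 Q with h0 | h0
    · positivity
    · nlinarith
  · obtain rfl : P = Q - 1 := by linarith
    rcases le_or_gt Q 0 with h0 | h0
    · nlinarith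
    · nlinarith

/-- Two Farey edges that meet have the same endpoints. -/
lemma openSegment_eq_of_mem_of_mem {u v x y : ℤ × ℤ} (h : FareyAdj u v) (h' : FareyAdj x y)
    {z : ℂ} (hz : z ∈ openSegment ℝ (fareyPoint u) (fareyPoint v))
    (hz' : z ∈ openSegment ℝ (fareyPoint x) (fareyPoint y)) :
    openSegment ℝ (fareyPoint u) (fareyPoint v) = openSegment ℝ (fareyPoint x) (fareyPoint y) := by
  have hu := h.nsq_pos
  have hv := h.symm.nsq_pos
  have hx := h'.nsq_pos
  have hy := h'.symm.nsq_pos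
  obtain ⟨a, b, ha, hb, hab, rfl⟩ := mem_openSegment_iff.1 hz
  obtain ⟨c, d, hc, hd, hcd, he⟩ := mem_openSegment_iff.1 hz'
  have h1 := chordForm_combination u v (A := fareyPoint u) (B := fareyPoint v) (C := 0)
    (x := a) (y := b) (w := 0) (by linarith)
  have h2 := chordForm_combination u v (A := fareyPoint x) (B := fareyPoint y) (C := 0)
    (x := c) (y := d) (w := 0) (by linarith)
  rw [zero_smul, add_zero, chordForm_fareyPoint _ _ hu, chordForm_fareyPoint _ _ hv] at h1
  rw [zero_smul, add_zero, ← he, h1, chordForm_fareyPoint _ _ hx, chordForm_fareyPoint _ _ hy]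
    at h2
  have hself : ∀ a : ℤ × ℤ, fdet a a = 0 := fun a => by simp only [fdet]; ring
  rw [hself, hself] at h2
  simp only [zero_mul, mul_zero, Int.cast_zero, zero_div, add_zero] at h2
  have hnc : (0 : ℝ) ≤ (fdet x u * fdet x v : ℤ) * (fdet y u * fdet y v : ℤ) := by
    exact_mod_cast h.not_cross h'
  have hzero : (fdet x u * fdet x v : ℤ) = 0 ∧ (fdet y u * fdet y v : ℤ) = 0 := by
    have key : ∀ P Q p q : ℝ, 0 < p → 0 < q → 0 ≤ P * Q → 0 = p * P + q * Q → P = 0 ∧ Q = 0 := by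
      intro P Q p q hp hq hPQ hs
      have hP : p * (P * P) ≤ 0 := by
        have : p * (P * P) = -(q * (P * Q)) := by linear_combination -P * hs
        rw [this]
        exact neg_nonpos.2 (mul_nonneg hq.le hPQ)
      have hP0 : P = 0 := by
        by_contra hne
        exact hP.not_gt (mul_pos hp (mul_self_pos.2 hne))
      subst hP0
      exact ⟨rfl, by simpa [hq.ne'] using hs.symm⟩
    obtain ⟨h3, h4⟩ := key _ _ (c / nsq x) (d / nsq y) (by positivity) (by positivity) hnc
      (by rw [h2]; ring)
    exact ⟨by exact_mod_cast h3, by exact_mod_cast h4⟩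
  have hne := h'.fareyPoint_ne
  rcases mul_eq_zero.1 hzero.1 with h3 | h3 <;> rcases mul_eq_zero.1 hzero.2 with h4 | h4
  · rw [← fareyPoint_eq_iff hx hu] at h3
    rw [← fareyPoint_eq_iff hy hu] at h4
    exact absurd (h3.trans h4.symm) hne
  · rw [← fareyPoint_eq_iff hx hu] at h3
    rw [← fareyPoint_eq_iff hy hv] at h4
    rw [h3, h4]
  · rw [← fareyPoint_eq_iff hx hv] at h3
    rw [← fareyPoint_eq_iff hy hu] at h4
    rw [h3, h4, openSegment_symm]
  · rw [← fareyPoint_eq_iff hx hv] at h3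
    rw [← fareyPoint_eq_iff hy hv] at h4
    exact absurd (h3.trans h4.symm) hne

/-- If a positive combination of the Farey points of `x` and of two Farey neighbours of `x` is in an
open Farey triangle, then the Farey point of `x` is a vertex of the triangle: it lies on the inner
side of all three edges of the triangle, whereas the product of the three defining functions has
the wrong sign unless one of them vanishes. -/
lemma fareyPoint_mem_of_combination {u v w x y s : ℤ × ℤ} (huv : FareyAdj u v)
    (hvw : FareyAdj v w) (hwu : FareyAdj w u) (hxy : FareyAdj x y) (hxs : FareyAdj x s)
    {a b c : ℝ} (ha : 0 < a) (hb : 0 < b) (hc : 0 < c)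
    (habc : a + b + c = 1)
    (hz : a • fareyPoint x + b • fareyPoint y + c • fareyPoint s ∈
      interior (convexHull ℝ {fareyPoint u, fareyPoint v, fareyPoint w})) :
    fareyPoint x ∈ ({fareyPoint u, fareyPoint v, fareyPoint w} : Set ℂ) := by
  have hx := hxy.nsq_pos
  have hy := hxy.symm.nsq_pos
  have hs := hxs.symm.nsq_pos
  obtain ⟨p, q, r, hp, hq, hr, hpqr, he⟩ :=
    (mem_interior_triangle (signedArea_fareyPoint_ne_zero huv hvw hwu)).1 hz
  have hself : ∀ a : ℤ × ℤ, fdet a a = 0 := fun a => by simp only [fdet]; ring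
  -- The point `x` lies weakly on the same side of the edge `u v` as the opposite vertex `w`.
  have side : ∀ {u v w : ℤ × ℤ} {p q r : ℝ}, FareyAdj u v → FareyAdj v w → FareyAdj w u →
      0 < p → 0 < q → 0 < r → p + q + r = 1 →
      a • fareyPoint x + b • fareyPoint y + c • fareyPoint s =
        p • fareyPoint u + q • fareyPoint v + r • fareyPoint w →
      0 ≤ (fdet x u * fdet x v) * (fdet w u * fdet w v) := by
    intro u v w p q r huv hvw hwu hp hq hr hpqr he
    have h1 := chordForm_combination u v (A := fareyPoint x) (B := fareyPoint y)
      (C := fareyPoint s) habc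
    rw [he, chordForm_combination u v hpqr, chordForm_fareyPoint _ _ huv.nsq_pos,
      chordForm_fareyPoint _ _ hvw.nsq_pos, chordForm_fareyPoint _ _ hwu.nsq_pos,
      chordForm_fareyPoint _ _ hx, chordForm_fareyPoint _ _ hy, chordForm_fareyPoint _ _ hs,
      hself, hself] at h1
    simp only [zero_mul, mul_zero, Int.cast_zero, zero_div, zero_add] at h1
    have n1 := huv.not_cross hxy
    have n2 := huv.not_cross hxs
    have hW : fdet w u * fdet w v ≠ 0 :=
      mul_ne_zero hwu.fdet_ne_zero hvw.symm.fdet_ne_zero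
    generalize fdet w u * fdet w v = W at *
    generalize fdet x u * fdet x v = P at *
    generalize fdet y u * fdet y v = Q at *
    generalize fdet s u * fdet s v = R at *
    by_contra! hneg
    -- If `P` and `W` have opposite signs, then `Q` and `R` are on the side of `P`, too.
    have hP0 : P ≠ 0 := by rintro rfl; simp at hneg
    have hnegr : (P : ℝ) * W < 0 := by exact_mod_cast hneg
    have n1r : (0 : ℝ) ≤ P * Q := by exact_mod_cast n1
    have n2r : (0 : ℝ) ≤ P * R := by exact_mod_cast n2
    have hw := hwu.nsq_pos
    have e1 : r / nsq w * ((P : ℝ) * W) =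
        a / nsq x * ((P : ℝ) * P) + b / nsq y * ((P : ℝ) * Q) + c / nsq s * ((P : ℝ) * R) := by
      linear_combination (P : ℝ) * h1
    have e2 : r / nsq w * ((P : ℝ) * W) < 0 := mul_neg_of_pos_of_neg (by positivity) hnegr
    have e3 : 0 ≤ a / nsq x * ((P : ℝ) * P) := mul_nonneg (by positivity) (mul_self_nonneg _)
    have e4 : 0 ≤ b / nsq y * ((P : ℝ) * Q) := mul_nonneg (by positivity) n1r
    have e5 : 0 ≤ c / nsq s * ((P : ℝ) * R) := mul_nonneg (by positivity) n2r
    linarith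
  have s1 := side huv hvw hwu hp hq hr hpqr he
  have s2 := side hvw hwu huv hq hr hp (by linarith) (by rw [he]; abel)
  have s3 := side hwu huv hvw hr hp hq (by linarith) (by rw [he]; abel)
  have hprod : (fdet x u * fdet x v * (fdet w u * fdet w v)) *
      (fdet x v * fdet x w * (fdet u v * fdet u w)) *
      (fdet x w * fdet x u * (fdet v w * fdet v u)) =
      -((fdet x u * fdet x v * fdet x w) ^ 2 *
        (fdet u v ^ 2 * fdet v w ^ 2 * fdet w u ^ 2)) := by
    simp only [fdet]; ring
  have hnn := mul_nonneg (mul_nonneg s1 s2) s3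
  rw [hprod, huv.fdet_sq, hvw.fdet_sq, hwu.fdet_sq] at hnn
  have h0 : fdet x u * fdet x v * fdet x w = 0 := by
    have : (fdet x u * fdet x v * fdet x w) ^ 2 = 0 :=
      le_antisymm (by linarith) (sq_nonneg _)
    exact pow_eq_zero_iff two_ne_zero |>.1 this
  rcases mul_eq_zero.1 h0 with h0 | h0
  · rcases mul_eq_zero.1 h0 with h0 | h0
    · exact Or.inl ((fareyPoint_eq_iff hx huv.nsq_pos).2 h0)
    · exact Or.inr (Or.inl ((fareyPoint_eq_iff hx hvw.nsq_pos).2 h0))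
  · exact Or.inr (Or.inr ((fareyPoint_eq_iff hx hwu.nsq_pos).2 h0))

/-- Open Farey triangles are disjoint from Farey edges. -/
lemma disjoint_triangle_edge {V S : Set ℂ} (hV : V ∈ fareyTriangles) (hS : S ∈ fareyEdges) :
    Disjoint (interior (convexHull ℝ V)) S := by
  obtain ⟨u, v, w, huv, hvw, hwu, rfl⟩ := hV
  obtain ⟨x, y, hxy, rfl⟩ := hS
  rw [disjoint_left]
  intro z hz hzS
  have hA := signedArea_fareyPoint_ne_zero huv hvw hwu
  obtain ⟨a, b, ha, hb, hab, he⟩ := mem_openSegment_iff.1 hzS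
  have hx := fareyPoint_mem_of_combination huv hvw hwu hxy hxy ha (half_pos hb)
    (half_pos hb) (by linarith) (by rwa [add_assoc, ← add_smul, add_halves, ← he])
  have hy := fareyPoint_mem_of_combination huv hvw hwu hxy.symm hxy.symm hb
    (half_pos ha) (half_pos ha) (by linarith)
    (by rwa [add_assoc, ← add_smul, add_halves, add_comm, ← he])
  have hne := hxy.fareyPoint_ne
  have hfr : z ∉ frontier (convexHull ℝ {fareyPoint u, fareyPoint v, fareyPoint w}) :=
    fun h => h.2 hz
  refine hfr ((mem_frontier_triangle_diff hA).2 ?_).1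
  rcases hx with hx | hx | hx <;> rcases hy with hy | hy | hy <;> rw [hx, hy] at hzS hne
  all_goals first
    | exact absurd rfl hne
    | exact Or.inl hzS
    | exact Or.inr (Or.inl hzS)
    | exact Or.inr (Or.inr hzS)
    | (rw [openSegment_symm] at hzS
       first
        | exact Or.inl hzS
        | exact Or.inr (Or.inl hzS)
        | exact Or.inr (Or.inr hzS))

lemma triangle_subset_of_mem_of_mem {V V' : Set ℂ} (hV : V ∈ fareyTriangles)
    (hV' : V' ∈ fareyTriangles) {z : ℂ} (hz : z ∈ interior (convexHull ℝ V))
    (hz' : z ∈ interior (convexHull ℝ V')) : V' ⊆ V := by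
  obtain ⟨u, v, w, huv, hvw, hwu, rfl⟩ := hV
  obtain ⟨x, y, s, hxy, hys, hsx, rfl⟩ := hV'
  obtain ⟨a, b, c, ha, hb, hc, hs, rfl⟩ :=
    (mem_interior_triangle (signedArea_fareyPoint_ne_zero hxy hys hsx)).1 hz'
  rintro t (rfl | rfl | rfl)
  · exact fareyPoint_mem_of_combination huv hvw hwu hxy hsx.symm ha hb hc hs hz
  · refine fareyPoint_mem_of_combination huv hvw hwu hys hxy.symm hb hc ha
      (by linarith) ?_
    convert hz using 1
    abel
  · refine fareyPoint_mem_of_combination huv hvw hwu hsx hys.symm hc ha hb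
      (by linarith) ?_
    convert hz using 1
    abel

/-- Open Farey triangles that meet are equal. -/
lemma triangle_eq_of_mem_of_mem {V V' : Set ℂ} (hV : V ∈ fareyTriangles)
    (hV' : V' ∈ fareyTriangles) {z : ℂ} (hz : z ∈ interior (convexHull ℝ V))
    (hz' : z ∈ interior (convexHull ℝ V')) : V = V' :=
  (triangle_subset_of_mem_of_mem hV' hV hz' hz).antisymm
    (triangle_subset_of_mem_of_mem hV hV' hz hz')

/-! ### Farey triangles cover the disk -/

/-- The quadratic form `chordForm x x z` is positive definite for `z` in the disk. -/
lemma mul_nsq_le_chordForm_self (x : ℤ × ℤ) (z : ℂ) :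
    (1 - ‖z‖) / 2 * nsq x ≤ chordForm x x z := by
  have h1 : (z.re * ((x.1 : ℝ) ^ 2 - x.2 ^ 2) - z.im * (2 * x.1 * x.2)) ≤ ‖z‖ * nsq x := by
    have hz : ‖z‖ ^ 2 = z.re ^ 2 + z.im ^ 2 := by
      rw [← Complex.normSq_eq_norm_sq, Complex.normSq_apply]; ring
    have hn : 0 ≤ nsq x := by unfold nsq; positivity
    refine abs_le_of_sq_le_sq' ?_ (by positivity) |>.2
    rw [mul_pow, hz]
    -- Lagrange's identity
    have : (z.re ^ 2 + z.im ^ 2) * nsq x ^ 2 =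
        (z.re * ((x.1 : ℝ) ^ 2 - x.2 ^ 2) - z.im * (2 * x.1 * x.2)) ^ 2 +
          (z.re * (2 * x.1 * x.2) + z.im * ((x.1 : ℝ) ^ 2 - x.2 ^ 2)) ^ 2 := by
      simp only [nsq]; ring
    rw [this]
    exact le_add_of_nonneg_right (sq_nonneg _)
  simp only [chordForm, nsq] at *
  linarith

/-- Selling reduction: for every point `z` of the disk there are three pairwise adjacent integer
vectors with sum zero whose mutual `chordForm` products at `z` are nonpositive, namely those that
minimize the sum of the three values of the quadratic form. -/
lemma exists_obtuse_superbase {z : ℂ} (hz : ‖z‖ < 1) :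
    ∃ u v w : ℤ × ℤ, fdet u v = 1 ∧ w = -(u + v) ∧ chordForm u v z ≤ 0 ∧ chordForm v w z ≤ 0 ∧
      chordForm w u z ≤ 0 := by
  let Q : ℤ × ℤ → ℝ := fun x => chordForm x x z
  let f : (ℤ × ℤ) × (ℤ × ℤ) → ℝ := fun p => Q p.1 + Q p.2 + Q (p.1 + p.2)
  have hε : 0 < (1 - ‖z‖) / 2 := by linarith
  have hnn : ∀ x, 0 ≤ nsq x := fun x => by unfold nsq; positivity
  have hQ : ∀ x, 0 ≤ Q x := fun x =>
    (mul_nonneg hε.le (hnn x)).trans (mul_nsq_le_chordForm_self x z)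
  have hQn : ∀ x C, Q x ≤ C → nsq x ≤ C / ((1 - ‖z‖) / 2) := fun x C h => by
    rw [le_div_iff₀ hε, mul_comm]
    exact (mul_nsq_le_chordForm_self x z).trans h
  let p₀ : (ℤ × ℤ) × (ℤ × ℤ) := ((1, 0), (0, 1))
  obtain ⟨p, ⟨hpdet, hpC⟩, hpmin⟩ : ∃ p ∈ {p | fdet p.1 p.2 = 1 ∧ f p ≤ f p₀},
      ∀ q ∈ {p | fdet p.1 p.2 = 1 ∧ f p ≤ f p₀}, f p ≤ f q := by
    refine Set.exists_min_image _ f ?_ ⟨p₀, by simp [p₀, fdet], le_rfl⟩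
    refine ((finite_nsq_le (f p₀ / ((1 - ‖z‖) / 2))).prod
      (finite_nsq_le (f p₀ / ((1 - ‖z‖) / 2)))).subset fun p hp => ?_
    have h1 : Q p.1 + Q p.2 + Q (p.1 + p.2) ≤ f p₀ := hp.2
    have h2 := hQ p.1
    have h3 := hQ p.2
    have h4 := hQ (p.1 + p.2)
    exact ⟨hQn _ _ (by linarith), hQn _ _ (by linarith)⟩
  have hmin : ∀ q : (ℤ × ℤ) × (ℤ × ℤ), fdet q.1 q.2 = 1 → f p ≤ f q := fun q hq => by
    by_cases h : f q ≤ f p₀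
    · exact hpmin q ⟨hq, h⟩
    · exact hpC.trans (not_le.1 h).le
  -- A positive product could be removed by passing from `u, v, -u - v` to `-v, u, v - u`.
  have key : ∀ u v : ℤ × ℤ, fdet u v = 1 → f (u, v) = f p → chordForm u v z ≤ 0 := by
    intro u v huv hf
    have h1 := hmin (-v, u) (by rw [← huv]; simp [fdet]; ring)
    rw [← hf] at h1
    simp only [f, Q, chordForm, Prod.fst_add, Prod.snd_add, Prod.fst_neg, Prod.snd_neg] at h1 ⊢
    push_cast at h1
    linarith
  obtain ⟨u, v⟩ := p
  refine ⟨u, v, -(u + v), hpdet, rfl, key u v hpdet rfl, key v _ ?_ ?_, key _ u ?_ ?_⟩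
  · rw [← hpdet]; simp only [fdet, Prod.fst_add, Prod.snd_add, Prod.fst_neg, Prod.snd_neg]; ring
  · simp only [f, Q, chordForm, Prod.fst_add, Prod.snd_add, Prod.fst_neg, Prod.snd_neg]
    push_cast
    ring
  · rw [← hpdet]; simp only [fdet, Prod.fst_add, Prod.snd_add, Prod.fst_neg, Prod.snd_neg]; ring
  · simp only [f, Q, chordForm, Prod.fst_add, Prod.snd_add, Prod.fst_neg, Prod.snd_neg]
    push_cast
    ring

/-- Every point of the disk is on a Farey edge or in an open Farey triangle. -/
lemma mem_edge_or_mem_triangle {z : ℂ} (hz : ‖z‖ < 1) :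
    (∃ S ∈ fareyEdges, z ∈ S) ∨ ∃ V ∈ fareyTriangles, z ∈ interior (convexHull ℝ V) := by
  obtain ⟨u, v, w, huv, hw, h1, h2, h3⟩ := exists_obtuse_superbase hz
  have auv : FareyAdj u v := by rw [fareyAdj_iff, huv, abs_one]
  have avw : FareyAdj v w := by
    have : fdet v w = 1 := by
      rw [← huv, hw]
      simp only [fdet, Prod.fst_add, Prod.snd_add, Prod.fst_neg, Prod.snd_neg]; ring
    rw [fareyAdj_iff, this, abs_one]
  have awu : FareyAdj w u := by
    have : fdet w u = 1 := by
      rw [← huv, hw]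
      simp only [fdet, Prod.fst_add, Prod.snd_add, Prod.fst_neg, Prod.snd_neg]; ring
    rw [fareyAdj_iff, this, abs_one]
  have nu := auv.nsq_pos
  have nv := avw.nsq_pos
  have nw := awu.nsq_pos
  have hdet : (u.1 : ℝ) * v.2 - u.2 * v.1 = 1 := by
    have : u.1 * v.2 - u.2 * v.1 = 1 := huv
    exact_mod_cast this
  obtain ⟨ur, ui⟩ := fareyPoint_re_im u
  obtain ⟨vr, vi⟩ := fareyPoint_re_im v
  obtain ⟨wr, wi⟩ := fareyPoint_re_im w
  set x := -chordForm v w z * nsq u with hx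
  set y := -chordForm w u z * nsq v with hy
  set t := -chordForm u v z * nsq w with ht
  have hx0 : 0 ≤ x := mul_nonneg (by linarith) nu.le
  have hy0 : 0 ≤ y := mul_nonneg (by linarith) nv.le
  have ht0 : 0 ≤ t := mul_nonneg (by linarith) nw.le
  have hsum : x + y + t = 1 := by
    have : x + y + t = ((u.1 : ℝ) * v.2 - u.2 * v.1) ^ 2 := by
      simp only [hx, hy, ht, hw, chordForm, nsq, Prod.fst_add, Prod.snd_add, Prod.fst_neg,
        Prod.snd_neg]
      push_cast
      ring
    rw [this, hdet, one_pow]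
  have hcomb : z = x • fareyPoint u + y • fareyPoint v + t • fareyPoint w := by
    have nu' := nu.ne'
    have nv' := nv.ne'
    have nw' := nw.ne'
    apply Complex.ext
    · have : z.re * ((u.1 : ℝ) * v.2 - u.2 * v.1) ^ 2 = x * (fareyPoint u).re +
          y * (fareyPoint v).re + t * (fareyPoint w).re := by
        rw [ur, vr, wr, hx, hy, ht]
        field_simp
        simp only [hw, chordForm, Prod.fst_add, Prod.snd_add, Prod.fst_neg, Prod.snd_neg]
        push_cast
        ring
      rw [hdet, one_pow, mul_one] at this
      simpa using this
    · have : z.im * ((u.1 : ℝ) * v.2 - u.2 * v.1) ^ 2 = x * (fareyPoint u).im +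
          y * (fareyPoint v).im + t * (fareyPoint w).im := by
        rw [ui, vi, wi, hx, hy, ht]
        field_simp
        simp only [hw, chordForm, Prod.fst_add, Prod.snd_add, Prod.fst_neg, Prod.snd_neg]
        push_cast
        ring
      rw [hdet, one_pow, mul_one] at this
      simpa using this
  have hA := signedArea_fareyPoint_ne_zero auv avw awu
  by_cases hi : z ∈ interior (convexHull ℝ {fareyPoint u, fareyPoint v, fareyPoint w})
  · exact Or.inr ⟨_, ⟨u, v, w, auv, avw, awu, rfl⟩, hi⟩
  · left
    have hfr : z ∈ frontier (convexHull ℝ {fareyPoint u, fareyPoint v, fareyPoint w}) := by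
      rw [(isClosed_triangle _ _ _).frontier_eq]
      exact ⟨(mem_triangle hA).2 ⟨x, y, t, hx0, hy0, ht0, hsum, hcomb⟩, hi⟩
    have hne : z ∉ ({fareyPoint u, fareyPoint v, fareyPoint w} : Set ℂ) := by
      rintro (rfl | rfl | rfl)
      · exact hz.ne (norm_fareyPoint nu)
      · exact hz.ne (norm_fareyPoint nv)
      · exact hz.ne (norm_fareyPoint nw)
    rcases (mem_frontier_triangle_diff hA).1 ⟨hfr, hne⟩ with h | h | h
    · exact ⟨_, ⟨u, v, auv, rfl⟩, h⟩
    · exact ⟨_, ⟨v, w, avw, rfl⟩, h⟩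
    · exact ⟨_, ⟨w, u, awu, rfl⟩, h⟩

/-! ### Local finiteness of the Farey triangulation -/

/-- If the hull of a Farey point and some of its neighbours meets the disk of radius `ρ < 1`, then
the Farey point has bounded height, since edges at a Farey point of large height are short. -/
lemma nsq_le_of_convexHull_inter {ρ : ℝ} (hρ : ρ < 1) {u : ℤ × ℤ} (hu : 0 < nsq u) {V : Set ℂ}
    (hV : ∀ p ∈ V, p = fareyPoint u ∨ ∃ v, FareyAdj u v ∧ p = fareyPoint v) {z : ℂ}
    (hz : z ∈ convexHull ℝ V) (hzρ : ‖z‖ ≤ ρ) : nsq u ≤ 4 / (1 - ρ) ^ 2 := by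
  by_contra! hlt
  have hρ' : 0 < 1 - ρ := by linarith
  rw [div_lt_iff₀ (by positivity)] at hlt
  have hsub : V ⊆ ball (fareyPoint u) (1 - ρ) := by
    intro p hp
    rcases hV p hp with rfl | ⟨v, huv, rfl⟩
    · exact mem_ball_self hρ'
    · rw [mem_ball, dist_eq_norm]
      have h1 := norm_sub_fareyPoint_sq huv.symm.nsq_pos huv.nsq_pos
      have h2 : (fdet v u : ℝ) ^ 2 = 1 := by exact_mod_cast huv.symm.fdet_sq
      rw [h2] at h1
      have h3 := huv.symm.one_le_nsq
      by_contra! hle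
      have h4 : (1 - ρ) ^ 2 ≤ ‖fareyPoint v - fareyPoint u‖ ^ 2 :=
        pow_le_pow_left₀ hρ'.le hle 2
      have h5 : nsq u ≤ nsq v * nsq u := le_mul_of_one_le_left hu.le h3
      have h6 : (1 - ρ) ^ 2 * nsq u ≤ ‖fareyPoint v - fareyPoint u‖ ^ 2 * (nsq v * nsq u) :=
        mul_le_mul h4 h5 hu.le (by positivity)
      linarith
  have hz' := convexHull_min hsub (convex_ball _ _) hz
  rw [mem_ball, dist_comm, dist_eq_norm] at hz'
  have := norm_sub_norm_le (fareyPoint u) z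
  rw [norm_fareyPoint hu] at this
  linarith

lemma finite_edges_inter_closedBall {ρ : ℝ} (hρ : ρ < 1) :
    {S ∈ fareyEdges | (S ∩ closedBall 0 ρ).Nonempty}.Finite := by
  refine (Finite.image2 (openSegment ℝ) ((finite_nsq_le (4 / (1 - ρ) ^ 2)).image fareyPoint)
    ((finite_nsq_le (4 / (1 - ρ) ^ 2)).image fareyPoint)).subset ?_
  rintro _ ⟨⟨u, v, huv, rfl⟩, z, hz, hzρ⟩
  rw [mem_closedBall_zero_iff] at hzρ
  have hz' : z ∈ convexHull ℝ {fareyPoint u, fareyPoint v} := by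
    rw [convexHull_pair]
    exact openSegment_subset_segment ℝ _ _ hz
  refine ⟨_, ⟨u, ?_, rfl⟩, _, ⟨v, ?_, rfl⟩, rfl⟩
  · refine nsq_le_of_convexHull_inter hρ huv.nsq_pos ?_ hz' hzρ
    rintro p (rfl | rfl)
    exacts [Or.inl rfl, Or.inr ⟨v, huv, rfl⟩]
  · refine nsq_le_of_convexHull_inter hρ huv.symm.nsq_pos ?_ hz' hzρ
    rintro p (rfl | rfl)
    exacts [Or.inr ⟨u, huv.symm, rfl⟩, Or.inl rfl]

lemma finite_triangles_inter_closedBall {ρ : ℝ} (hρ : ρ < 1) :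
    {V ∈ fareyTriangles | (convexHull ℝ V ∩ closedBall 0 ρ).Nonempty}.Finite := by
  refine (((finite_nsq_le (4 / (1 - ρ) ^ 2)).image fareyPoint).powerset).subset ?_
  rintro _ ⟨⟨u, v, w, huv, hvw, hwu, rfl⟩, z, hz, hzρ⟩
  rw [mem_closedBall_zero_iff] at hzρ
  rintro _ (rfl | rfl | rfl)
  · refine ⟨u, nsq_le_of_convexHull_inter hρ huv.nsq_pos ?_ hz hzρ, rfl⟩
    rintro p (rfl | rfl | rfl)
    exacts [Or.inl rfl, Or.inr ⟨v, huv, rfl⟩, Or.inr ⟨w, hwu.symm, rfl⟩]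
  · refine ⟨v, nsq_le_of_convexHull_inter hρ hvw.nsq_pos ?_ hz hzρ, rfl⟩
    rintro p (rfl | rfl | rfl)
    exacts [Or.inr ⟨u, huv.symm, rfl⟩, Or.inl rfl, Or.inr ⟨w, hvw, rfl⟩]
  · refine ⟨w, nsq_le_of_convexHull_inter hρ hwu.nsq_pos ?_ hz hzρ, rfl⟩
    rintro p (rfl | rfl | rfl)
    exacts [Or.inr ⟨u, hwu, rfl⟩, Or.inr ⟨v, hvw.symm, rfl⟩, Or.inl rfl]

lemma countable_fareyEdges : fareyEdges.Countable := by
  refine (countable_range fun p : (ℤ × ℤ) × (ℤ × ℤ) =>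
    openSegment ℝ (fareyPoint p.1) (fareyPoint p.2)).mono ?_
  rintro _ ⟨u, v, -, rfl⟩
  exact ⟨(u, v), rfl⟩

lemma countable_fareyTriangles : fareyTriangles.Countable := by
  refine (countable_range fun p : (ℤ × ℤ) × (ℤ × ℤ) × (ℤ × ℤ) =>
    ({fareyPoint p.1, fareyPoint p.2.1, fareyPoint p.2.2} : Set ℂ)).mono ?_
  rintro _ ⟨u, v, w, -, -, -, rfl⟩
  exact ⟨(u, v, w), rfl⟩

/-- The triangles with vertices `∞`, `n`, `n + 1` are different. -/
lemma infinite_fareyTriangles : fareyTriangles.Infinite := by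
  let V : ℕ → Set ℂ := fun n =>
    {fareyPoint (1, 0), fareyPoint (n, 1), fareyPoint (n + 1, 1)}
  have hpos : ∀ a : ℤ, 0 < nsq (a, 1) := fun a => by simp only [nsq]; positivity
  have hpos' : 0 < nsq (1, 0) := by simp [nsq]
  refine infinite_of_injective_forall_mem (f := V) ?_ fun n =>
    ⟨(1, 0), (n, 1), (n + 1, 1), by simp [FareyAdj], by simp [FareyAdj], by simp [FareyAdj], rfl⟩
  have key : ∀ n m, V n = V m → m ≤ n := by
    intro n m h
    have h1 : fareyPoint (n, 1) ∈ V m := h ▸ Or.inr (Or.inl rfl)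
    simp only [V, mem_insert_iff, mem_singleton_iff, fareyPoint_eq_iff (hpos _) (hpos _),
      fareyPoint_eq_iff (hpos _) hpos', fdet] at h1
    omega
  exact fun n m h => le_antisymm (key m n h.symm) (key n m h)

lemma FareyAdj.openSegment_subset_ball {u v : ℤ × ℤ} (h : FareyAdj u v) :
    openSegment ℝ (fareyPoint u) (fareyPoint v) ⊆ ball 0 1 := by
  refine openSegment_subset_ball_of_ne ?_ ?_ h.fareyPoint_ne
  · simp [norm_fareyPoint h.nsq_pos]
  · simp [norm_fareyPoint h.symm.nsq_pos]

lemma norm_of_mem_fareyTriangle {V : Set ℂ} (hV : V ∈ fareyTriangles) {p : ℂ} (hp : p ∈ V) :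
    ‖p‖ = 1 := by
  obtain ⟨u, v, w, huv, hvw, hwu, rfl⟩ := hV
  rcases hp with rfl | rfl | rfl
  exacts [norm_fareyPoint huv.nsq_pos, norm_fareyPoint hvw.nsq_pos, norm_fareyPoint hwu.nsq_pos]

lemma interior_triangle_subset_ball {V : Set ℂ} (hV : V ∈ fareyTriangles) :
    interior (convexHull ℝ V) ⊆ ball 0 1 := by
  have : convexHull ℝ V ⊆ closedBall 0 1 :=
    convexHull_min (fun p hp => by simp [norm_of_mem_fareyTriangle hV hp]) (convex_closedBall _ _)
  rw [← interior_closedBall (0 : ℂ) one_ne_zero]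
  exact interior_mono this

/-! ### Subdividing a triangle at an interior point -/

/-- The ratio of the barycentric coordinates of `z` and of `c` at the vertex opposite to the side
`q r` of a triangle. The comparison of these three ratios tells in which part of the triangle,
subdivided at its interior point `c`, the point `z` is. -/
noncomputable def coordRatio (c q r z : ℂ) : ℝ := signedArea z q r / signedArea c q r

lemma signedArea_ne_zero_of_mem_interior {p q r c : ℂ} (h : signedArea p q r ≠ 0)
    (hc : c ∈ interior (convexHull ℝ {p, q, r})) : signedArea c p q ≠ 0 := by
  obtain ⟨α, β, γ, hα, hβ, hγ, hs, rfl⟩ := (mem_interior_triangle h).1 hc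
  rw [signedArea_combination₃ hs]
  exact mul_ne_zero hγ.ne' h

/-- In the part `c p q`, the ratio at `r` is the smallest. -/
lemma coordRatio_lt_of_mem_cell {p q r c z : ℂ} (h : signedArea p q r ≠ 0)
    (hc : c ∈ interior (convexHull ℝ {p, q, r})) (hz : z ∈ interior (convexHull ℝ {c, p, q})) :
    coordRatio c p q z < coordRatio c q r z ∧ coordRatio c p q z < coordRatio c r p z := by
  have h' := signedArea_ne_zero_of_mem_interior h hc
  obtain ⟨x, y, w, hx, hy, hw, hs, rfl⟩ := (mem_interior_triangle h').1 hz
  obtain ⟨α, β, γ, hα, hβ, hγ, hs', rfl⟩ := (mem_interior_triangle h).1 hc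
  have he : x • (α • p + β • q + γ • r) + y • p + w • q =
      (x * α + y) • p + (x * β + w) • q + (x * γ) • r := by
    module
  have hs'' : (x * α + y) + (x * β + w) + x * γ = 1 := by
    have : x * (α + β + γ) + y + w = 1 := by rw [hs']; linarith
    linarith
  unfold coordRatio
  rw [he, signedArea_combination hs'', signedArea_combination₂ hs'', signedArea_combination₃ hs'',
    signedArea_combination hs', signedArea_combination₂ hs', signedArea_combination₃ hs']
  rw [mul_div_mul_right _ _ h, mul_div_mul_right _ _ h, mul_div_mul_right _ _ h,
    mul_div_cancel_right₀ _ hγ.ne']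
  constructor
  · rw [lt_div_iff₀ hα]; linarith
  · rw [lt_div_iff₀ hβ]; linarith

/-- On the spoke `c p`, the ratios at `q` and `r` are equal and smaller than that at `p`. -/
lemma coordRatio_of_mem_spoke {p q r c z : ℂ} (h : signedArea p q r ≠ 0)
    (hc : c ∈ interior (convexHull ℝ {p, q, r})) (hz : z ∈ openSegment ℝ c p) :
    coordRatio c p q z = coordRatio c r p z ∧ coordRatio c p q z < coordRatio c q r z := by
  obtain ⟨x, y, hx, hy, hs, rfl⟩ := mem_openSegment_iff.1 hz
  obtain ⟨α, β, γ, hα, hβ, hγ, hs', rfl⟩ := (mem_interior_triangle h).1 hc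
  have he : x • (α • p + β • q + γ • r) + y • p =
      (x * α + y) • p + (x * β) • q + (x * γ) • r := by
    module
  have hs'' : (x * α + y) + (x * β) + x * γ = 1 := by
    have : x * (α + β + γ) + y = 1 := by rw [hs']; linarith
    linarith
  unfold coordRatio
  rw [he, signedArea_combination hs'', signedArea_combination₂ hs'', signedArea_combination₃ hs'',
    signedArea_combination hs', signedArea_combination₂ hs', signedArea_combination₃ hs']
  rw [mul_div_mul_right _ _ h, mul_div_mul_right _ _ h, mul_div_mul_right _ _ h,
    mul_div_cancel_right₀ _ hγ.ne', mul_div_cancel_right₀ _ hβ.ne']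
  refine ⟨rfl, ?_⟩
  rw [lt_div_iff₀ hα]; linarith

/-- If the ratio of barycentric coordinates is smallest at `r`, then `z` is in the closed part
`c p q`: subtract from `z` the multiple of `c` that cancels the coordinate at `r`. -/
lemma mem_subdivision_of_le {p q r : ℂ} {α β γ x y w : ℝ} (h : signedArea p q r ≠ 0) (hα : 0 < α)
    (hβ : 0 < β) (hγ : 0 < γ) (hs : α + β + γ = 1) (hw : 0 < w) (hs' : x + y + w = 1)
    (h1 : w * α ≤ x * γ) (h2 : w * β ≤ y * γ) {c z : ℂ} (hc : c = α • p + β • q + γ • r)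
    (hz : z = x • p + y • q + w • r) :
    z = c ∨ z ∈ openSegment ℝ c p ∨ z ∈ openSegment ℝ c q ∨
      z ∈ interior (convexHull ℝ {c, p, q}) := by
  have hci : c ∈ interior (convexHull ℝ {p, q, r}) :=
    (mem_interior_triangle h).2 ⟨α, β, γ, hα, hβ, hγ, hs, hc⟩
  have hk : 0 < w / γ := div_pos hw hγ
  have e1 : 0 ≤ x - w / γ * α := by
    rw [sub_nonneg, div_mul_eq_mul_div, div_le_iff₀ hγ]; exact h1
  have e2 : 0 ≤ y - w / γ * β := by
    rw [sub_nonneg, div_mul_eq_mul_div, div_le_iff₀ hγ]; exact h2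
  have e3 : w / γ * γ = w := div_mul_cancel₀ w hγ.ne'
  have hsum : w / γ + (x - w / γ * α) + (y - w / γ * β) = 1 := by
    have : w / γ * (α + β + γ) = w / γ := by rw [hs, mul_one]
    linarith
  have hz' : z = (w / γ) • c + (x - w / γ * α) • p + (y - w / γ * β) • q := by
    rw [hz, hc]
    nth_rewrite 1 [← e3]
    module
  generalize w / γ = k at *
  generalize x - k * α = a at *
  generalize y - k * β = b at *
  rcases e1.eq_or_lt with rfl | e1
  · rcases e2.eq_or_lt with rfl | e2
    · obtain rfl : k = 1 := by linarith
      exact Or.inl (by simpa using hz')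
    · exact Or.inr (Or.inr (Or.inl (mem_openSegment_iff.2
        ⟨k, b, hk, e2, by linarith, by simpa using hz'⟩)))
  · rcases e2.eq_or_lt with rfl | e2
    · exact Or.inr (Or.inl (mem_openSegment_iff.2
        ⟨k, a, hk, e1, by linarith, by simpa using hz'⟩))
    · exact Or.inr (Or.inr (Or.inr ((mem_interior_triangle
        (signedArea_ne_zero_of_mem_interior h hci)).2 ⟨k, a, b, hk, e1, e2, hsum, hz'⟩)))

/-- A triangle is the union of the three parts, the three spokes and the point `c`. -/
lemma mem_subdivision {p q r c z : ℂ} (h : signedArea p q r ≠ 0)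
    (hc : c ∈ interior (convexHull ℝ {p, q, r})) (hz : z ∈ interior (convexHull ℝ {p, q, r})) :
    z = c ∨ (∃ s ∈ ({p, q, r} : Set ℂ), z ∈ openSegment ℝ c s) ∨
      z ∈ interior (convexHull ℝ {c, p, q}) ∨ z ∈ interior (convexHull ℝ {c, q, r}) ∨
      z ∈ interior (convexHull ℝ {c, r, p}) := by
  obtain ⟨α, β, γ, hα, hβ, hγ, hs, hc'⟩ := (mem_interior_triangle h).1 hc
  obtain ⟨x, y, w, hx, hy, hw, hs', hz'⟩ := (mem_interior_triangle h).1 hz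
  have hqr : signedArea q r p ≠ 0 := by rwa [signedArea_rotate]
  have hrp : signedArea r p q ≠ 0 := by rwa [signedArea_rotate, signedArea_rotate]
  have hcq : c = β • q + γ • r + α • p := by rw [hc']; abel
  have hzq : z = y • q + w • r + x • p := by rw [hz']; abel
  have hcr : c = γ • r + α • p + β • q := by rw [hc']; abel
  have hzr : z = w • r + x • p + y • q := by rw [hz']; abel
  have key : (w * α ≤ x * γ ∧ w * β ≤ y * γ) ∨ (x * β ≤ y * α ∧ x * γ ≤ w * α) ∨
      (y * γ ≤ w * β ∧ y * α ≤ x * β) := by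
    simp only [← div_le_div_iff₀ hα hγ, ← div_le_div_iff₀ hγ hα, ← div_le_div_iff₀ hβ hγ,
      ← div_le_div_iff₀ hγ hβ, ← div_le_div_iff₀ hβ hα, ← div_le_div_iff₀ hα hβ]
    grind
  rcases key with ⟨h1, h2⟩ | ⟨h1, h2⟩ | ⟨h1, h2⟩
  · rcases mem_subdivision_of_le h hα hβ hγ hs hw hs' h1 h2 hc' hz' with h | h | h | h
    · exact Or.inl h
    · exact Or.inr (Or.inl ⟨p, by simp, h⟩)
    · exact Or.inr (Or.inl ⟨q, by simp, h⟩)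
    · exact Or.inr (Or.inr (Or.inl h))
  · rcases mem_subdivision_of_le hqr hβ hγ hα (by linarith) hx (by linarith) h1 h2 hcq hzq
      with h | h | h | h
    · exact Or.inl h
    · exact Or.inr (Or.inl ⟨q, by simp, h⟩)
    · exact Or.inr (Or.inl ⟨r, by simp, h⟩)
    · exact Or.inr (Or.inr (Or.inr (Or.inl h)))
  · rcases mem_subdivision_of_le hrp hγ hα hβ (by linarith) hy (by linarith) h1 h2 hcr hzr
      with h | h | h | h
    · exact Or.inl h
    · exact Or.inr (Or.inl ⟨r, by simp, h⟩)
    · exact Or.inr (Or.inl ⟨p, by simp, h⟩)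
    · exact Or.inr (Or.inr (Or.inr (Or.inr h)))

section Subdivision

variable {p q r c : ℂ}

lemma disjoint_spokes (h : signedArea p q r ≠ 0)
    (hc : c ∈ interior (convexHull ℝ {p, q, r})) :
    Disjoint (openSegment ℝ c p) (openSegment ℝ c q) := by
  rw [disjoint_left]
  intro z hz hz'
  have h1 := coordRatio_of_mem_spoke h hc hz
  have h2 := coordRatio_of_mem_spoke (p := q) (q := r) (r := p)
    (by rwa [signedArea_rotate]) (by rwa [triple_rotate]) hz'
  linarith [h1.1, h1.2, h2.1, h2.2]

lemma disjoint_cell_cell (h : signedArea p q r ≠ 0)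
    (hc : c ∈ interior (convexHull ℝ {p, q, r})) :
    Disjoint (interior (convexHull ℝ {c, p, q})) (interior (convexHull ℝ {c, q, r})) := by
  rw [disjoint_left]
  intro z hz hz'
  have h1 := coordRatio_lt_of_mem_cell h hc hz
  have h2 := coordRatio_lt_of_mem_cell (p := q) (q := r) (r := p)
    (by rwa [signedArea_rotate]) (by rwa [triple_rotate]) hz'
  linarith [h1.1, h1.2, h2.1, h2.2]

lemma disjoint_cell_spoke (h : signedArea p q r ≠ 0)
    (hc : c ∈ interior (convexHull ℝ {p, q, r})) {s : ℂ} (hs : s ∈ ({p, q, r} : Set ℂ)) :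
    Disjoint (interior (convexHull ℝ {c, p, q})) (openSegment ℝ c s) := by
  rw [disjoint_left]
  intro z hz hz'
  have h1 := coordRatio_lt_of_mem_cell h hc hz
  rcases hs with rfl | rfl | rfl
  · have h2 := coordRatio_of_mem_spoke h hc hz'
    linarith [h1.1, h1.2, h2.1, h2.2]
  · have h2 := coordRatio_of_mem_spoke (q := r) (r := p)
      (by rwa [signedArea_rotate]) (by rwa [triple_rotate]) hz'
    linarith [h1.1, h1.2, h2.1, h2.2]
  · have h2 := coordRatio_of_mem_spoke (q := p) (r := q)
      (by rwa [signedArea_rotate, signedArea_rotate]) (by rwa [triple_rotate, triple_rotate]) hz'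
    linarith [h1.1, h1.2, h2.1, h2.2]

lemma cell_subset (hc : c ∈ interior (convexHull ℝ {p, q, r})) :
    interior (convexHull ℝ {c, p, q}) ⊆ interior (convexHull ℝ {p, q, r}) := by
  refine interior_mono (convexHull_min ?_ (convex_convexHull ℝ _))
  rintro x (rfl | rfl | rfl)
  · exact interior_subset hc
  · exact subset_convexHull _ _ (by simp)
  · exact subset_convexHull _ _ (by simp)

end Subdivision

/-! ### Ends of a punctured disk -/

/-- A set that is an injective continuous image of the plane with a countable set removed remains
connected when another countable set is removed. -/
lemma isConnected_image_diff_countable {g : ℂ → ℂ} {t P : Set ℂ} (ht : t.Countable)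
    (hP : P.Countable) (hg : ContinuousOn g tᶜ) (hinj : InjOn g tᶜ) :
    IsConnected (g '' tᶜ \ P) := by
  have hcount : (tᶜ ∩ g ⁻¹' P).Countable := by
    refine countable_of_injective_of_countable_image (hinj.mono inter_subset_left) (hP.mono ?_)
    rintro _ ⟨z, hz, rfl⟩
    exact hz.2
  have h := (ht.union hcount).isConnected_compl_of_one_lt_rank (E := ℂ)
    (by rw [Complex.rank_real_complex]; norm_num)
  have he : g '' tᶜ \ P = g '' (t ∪ (tᶜ ∩ g ⁻¹' P))ᶜ := by
    ext z
    constructor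
    · rintro ⟨⟨x, hx, rfl⟩, hz⟩
      refine ⟨x, ?_, rfl⟩
      rintro (h | h)
      exacts [hx h, hz h.2]
    · rintro ⟨x, hx, rfl⟩
      have hxt : x ∈ tᶜ := fun h => hx (Or.inl h)
      exact ⟨⟨x, hxt, rfl⟩, fun h => hx (Or.inr ⟨hxt, h⟩)⟩
  rw [he]
  refine h.image g (hg.mono ?_)
  rw [compl_subset_compl]
  exact subset_union_left

lemma isConnected_ball_diff_countable {P : Set ℂ} (hP : P.Countable) (p : ℂ) {r : ℝ}
    (hr : 0 < r) : IsConnected (ball p r \ P) := by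
  have h := isConnected_image_diff_countable (g := OpenPartialHomeomorph.univBall p r)
    countable_empty hP (OpenPartialHomeomorph.continuous_univBall p r).continuousOn
    (by
      have := (OpenPartialHomeomorph.univBall p r).injOn
      rw [OpenPartialHomeomorph.univBall_source] at this
      exact this.mono (subset_univ _))
  have him := (OpenPartialHomeomorph.univBall p r).image_source_eq_target
  rw [OpenPartialHomeomorph.univBall_source, OpenPartialHomeomorph.univBall_target _ hr] at him
  rwa [compl_empty, him] at h

lemma isConnected_annulus_diff_countable {P : Set ℂ} (hP : P.Countable) {ρ : ℝ} (h0 : 0 ≤ ρ)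
    (h1 : ρ < 1) : IsConnected ({z : ℂ | ρ < ‖z‖ ∧ ‖z‖ < 1} \ P) := by
  -- The punctured plane is mapped onto the annulus by stretching the modulus.
  let k : ℝ → ℝ := fun s => ρ + (1 - ρ) * (s / (1 + s))
  have hkpos : ∀ s, 0 < s → 0 < k s := fun s hs => by
    have : 0 < 1 - ρ := by linarith
    positivity
  have hnorm : ∀ z : ℂ, z ≠ 0 → ‖radialMap k z‖ = k ‖z‖ := fun z hz => by
    have hz' := norm_pos_iff.2 hz
    have := hkpos _ hz'
    rw [radialMap, norm_mul, Complex.norm_real, Real.norm_of_nonneg (by positivity)]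
    field_simp
  have hkinj : ∀ s t : ℝ, 0 < s → 0 < t → k s = k t → s = t := fun s t hs ht h => by
    have h2 : (1 - ρ) * (s / (1 + s)) = (1 - ρ) * (t / (1 + t)) := add_left_cancel h
    have h3 := mul_left_cancel₀ (by linarith) h2
    rw [div_eq_div_iff (by positivity) (by positivity)] at h3
    linarith
  have h := isConnected_image_diff_countable (g := radialMap k) (countable_singleton 0) hP
    (by
      intro z hz
      have hz' : ‖z‖ ≠ 0 := norm_ne_zero_iff.2 hz
      have hz'' : 1 + ‖z‖ ≠ 0 := by positivity
      refine ContinuousAt.continuousWithinAt ?_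
      unfold radialMap
      refine ContinuousAt.mul (Complex.continuous_ofReal.continuousAt.comp ?_) continuousAt_id
      refine ContinuousAt.div ?_ (by fun_prop) hz'
      exact continuousAt_const.add (continuousAt_const.mul
        (ContinuousAt.div (by fun_prop) (by fun_prop) hz'')))
    (by
      intro z hz w hw hzw
      have h2 := hnorm z hz
      rw [hzw, hnorm w hw] at h2
      have h3 := hkinj _ _ (norm_pos_iff.2 hw) (norm_pos_iff.2 hz) h2
      rw [radialMap, radialMap, h3] at hzw
      refine mul_left_cancel₀ ?_ hzw
      rw [Complex.ofReal_ne_zero]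
      have hz' := norm_pos_iff.2 hz
      exact (div_pos (hkpos _ hz') hz').ne')
  convert h using 2
  ext ζ
  constructor
  · rintro ⟨hζ, hζ'⟩
    have hζ0 : 0 < ‖ζ‖ := h0.trans_lt hζ
    set s := (‖ζ‖ - ρ) / (1 - ‖ζ‖) with hs
    have h2 : 0 < 1 - ‖ζ‖ := by linarith
    have h3 : 0 < 1 - ρ := by linarith
    have hs0 : 0 < s := div_pos (by linarith) h2
    have hks : k s = ‖ζ‖ := by
      have : 1 + s = (1 - ρ) / (1 - ‖ζ‖) := by rw [hs]; field_simp; ring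
      simp only [k]
      rw [this, hs]
      field_simp
      ring
    have hn : ‖((s / ‖ζ‖ : ℝ) : ℂ) * ζ‖ = s := by
      rw [norm_mul, Complex.norm_real, Real.norm_of_nonneg (by positivity)]
      field_simp
    refine ⟨((s / ‖ζ‖ : ℝ) : ℂ) * ζ, ?_, ?_⟩
    · rw [mem_compl_singleton_iff, ← norm_pos_iff, hn]
      exact hs0
    · rw [radialMap, hn, hks, ← mul_assoc, ← Complex.ofReal_mul]
      have : ‖ζ‖ / s * (s / ‖ζ‖) = 1 := by field_simp
      rw [this]; simp
  · rintro ⟨z, hz, rfl⟩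
    have hz' := norm_pos_iff.2 hz
    have h3 : 0 < 1 - ρ := by linarith
    have h4 : 0 < ‖z‖ / (1 + ‖z‖) := by positivity
    have h5 : ‖z‖ / (1 + ‖z‖) < 1 := by rw [div_lt_one (by positivity)]; linarith
    change ρ < ‖radialMap k z‖ ∧ ‖radialMap k z‖ < 1
    rw [hnorm z hz]
    simp only [k]
    constructor
    · linarith [mul_pos h3 h4]
    · have := mul_lt_mul_of_pos_left h5 h3
      linarith

/-- An end of a planar set `F`, given by a sequence of open sets of the plane. -/
def EndSeq.ofPlane {F : Set ℂ} (U : ℕ → Set ℂ) (hU : ∀ i, IsOpen (U i))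
    (hconn : ∀ i, IsConnected (U i ∩ F)) (hfr : ∀ i, frontier (U i) ⊆ F)
    (hcpt : ∀ i, IsCompact (frontier (U i))) (hanti : Antitone U)
    (hleaves : ∀ K : Set ℂ, IsCompact K → K ⊆ F → ∃ i, Disjoint (U i) K) : EndSeq F where
  nbhd i := (↑) ⁻¹' U i
  isOpen i := (hU i).preimage continuous_subtype_val
  isConnected i := by
    have h := hconn i
    rw [inter_comm, ← Subtype.image_preimage_coe] at h
    refine ⟨h.nonempty.of_image, ?_⟩
    rw [← IsInducing.subtypeVal.isPreconnected_image]
    exact h.isPreconnected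
  isCompact_frontier i := by
    refine IsCompact.of_isClosed_subset ?_ isClosed_frontier
      (continuous_subtype_val.frontier_preimage_subset (U i))
    rw [IsEmbedding.subtypeVal.isCompact_iff, image_val_preimage (hfr i)]
    exact hcpt i
  antitone _ _ hij := preimage_mono (hanti hij)
  leaves K hK := by
    obtain ⟨i, hi⟩ := hleaves (Subtype.val '' K) (hK.image continuous_subtype_val)
      (Subtype.coe_image_subset F K)
    refine ⟨i, ?_⟩
    rw [disjoint_left] at hi ⊢
    exact fun x hx hxK => hi hx (mem_image_of_mem _ hxK)

section PuncturedDisk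

variable {P : Set ℂ}

/-- A puncture is an end of the punctured disk: take small disks about it. -/
lemma exists_endSeq_puncture (hP : P.Countable) (hPD : P ⊆ ball 0 1)
    (hfin : ∀ ρ < 1, (P ∩ closedBall 0 ρ).Finite) {p : ℂ} (hp : p ∈ P) :
    ∃ e : EndSeq (ball (0 : ℂ) 1 \ P : Set ℂ), ∀ i, e.nbhd i ∈ comap Subtype.val (𝓝 p) := by
  have hp1 : ‖p‖ < 1 := by simpa using hPD hp
  obtain ⟨ρ, hρ, hρ1⟩ := exists_between hp1
  obtain ⟨r, hr, hrsub⟩ := nhds_basis_closedBall.mem_iff.1 <| inter_mem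
    (isOpen_ball.mem_nhds (mem_ball_zero_iff.2 hρ))
    ((((hfin ρ hρ1).subset (sdiff_subset (t := {p}))).isClosed.isOpen_compl).mem_nhds
      (fun h => h.2 rfl))
  have hD : closedBall p r ⊆ ball 0 1 := fun z hz => ball_subset_ball hρ1.le (hrsub hz).1
  have hPr : ∀ z ∈ closedBall p r, z ∈ P → z = p := fun z hz hzP => by
    by_contra hne
    exact (hrsub hz).2 ⟨⟨hzP, ball_subset_closedBall (hrsub hz).1⟩, hne⟩
  have hri : ∀ i : ℕ, 0 < r / (i + 1) := fun i => by positivity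
  have hle : ∀ i : ℕ, r / (i + 1) ≤ r := fun i =>
    div_le_self hr.le (by linarith [i.cast_nonneg (α := ℝ)])
  refine ⟨EndSeq.ofPlane (fun i : ℕ => ball p (r / (i + 1))) (fun i => isOpen_ball)
    (fun i => ?_) (fun i => ?_) (fun i => ?_) (fun i j hij => ?_) (fun K hK hKF => ?_),
    fun i => ⟨_, isOpen_ball.mem_nhds (mem_ball_self (hri i)), Subset.rfl⟩⟩
  · have : ball p (r / (i + 1)) ∩ (ball 0 1 \ P) = ball p (r / (i + 1)) \ P := by
      ext z
      refine ⟨fun h => ⟨h.1, h.2.2⟩, fun h => ⟨h.1, hD ?_, h.2⟩⟩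
      exact closedBall_subset_closedBall (hle i) (ball_subset_closedBall h.1)
    rw [this]
    exact isConnected_ball_diff_countable hP p (hri i)
  · rw [frontier_ball _ (hri i).ne']
    intro z hz
    have hz' := closedBall_subset_closedBall (hle i) (sphere_subset_closedBall hz)
    refine ⟨hD hz', fun hzP => ?_⟩
    rw [hPr z hz' hzP, mem_sphere, dist_self] at hz
    exact (hri i).ne hz
  · rw [frontier_ball _ (hri i).ne']
    exact isCompact_sphere _ _
  · have hij' : (i : ℝ) ≤ j := Nat.cast_le.2 hij
    exact ball_subset_ball (div_le_div_of_nonneg_left hr.le (by positivity) (by linarith))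
  · have hpK : p ∉ K := fun h => (hKF h).2 hp
    obtain ⟨ε, hε, hεK⟩ := Metric.mem_nhds_iff.1 (hK.isClosed.isOpen_compl.mem_nhds hpK)
    obtain ⟨n, hn⟩ := exists_nat_gt (r / ε)
    refine ⟨n, ?_⟩
    rw [disjoint_left]
    refine fun z hz hzK => hεK (ball_subset_ball ?_ hz) hzK
    rw [div_lt_iff₀ hε] at hn
    rw [div_le_iff₀ (by positivity)]
    linarith

/-- A point of the unit circle is approached through an end of the punctured disk: take annuli
whose inner boundary circles avoid the punctures. -/
lemma exists_endSeq_circle (hP : P.Countable) {p : ℂ} (hp : ‖p‖ = 1) :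
    ∃ e : EndSeq (ball (0 : ℂ) 1 \ P : Set ℂ), ∀ i, e.nbhd i ∈ comap Subtype.val (𝓝 p) := by
  have hex : ∀ i : ℕ, ∃ ρ : ℝ, ρ ∈ Ioo (1 - 1 / ((i : ℝ) + 1)) (1 - 1 / ((i : ℝ) + 2)) ∧
      ρ ∉ norm '' P := fun i => by
    have hlt : 1 - 1 / ((i : ℝ) + 1) < 1 - 1 / ((i : ℝ) + 2) := by
      have := one_div_lt_one_div_of_lt (by positivity : (0 : ℝ) < i + 1)
        (by linarith : (i : ℝ) + 1 < i + 2)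
      linarith
    obtain ⟨ρ, h1, h2⟩ := ((hP.image norm).dense_compl ℝ).exists_between hlt
    exact ⟨ρ, h2, h1⟩
  choose ρ hρ hρP using hex
  have h0 : ∀ i, 0 < ρ i := fun i => by
    have : 1 / ((i : ℝ) + 1) ≤ 1 := by
      rw [div_le_one (by positivity)]; linarith [i.cast_nonneg (α := ℝ)]
    linarith [(hρ i).1]
  have h1 : ∀ i, ρ i < 1 := fun i => by
    have : 0 < 1 / ((i : ℝ) + 2) := by positivity
    linarith [(hρ i).2]
  have hmono : Monotone ρ := monotone_nat_of_le_succ fun i => by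
    have h2 := (hρ (i + 1)).1
    have h3 := (hρ i).2
    push_cast at h2
    rw [add_assoc, one_add_one_eq_two] at h2
    linarith
  have hfr : ∀ i, frontier {z : ℂ | ρ i < ‖z‖} ⊆ sphere 0 (ρ i) := fun i z hz => by
    have := frontier_lt_subset_eq continuous_const continuous_norm hz
    simpa using this.symm
  refine ⟨EndSeq.ofPlane (fun i => {z : ℂ | ρ i < ‖z‖})
    (fun i => isOpen_lt continuous_const continuous_norm)
    (fun i => ?_) (fun i => ?_) (fun i => ?_) (fun i j hij z hz => ?_) (fun K hK hKF => ?_),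
    fun i => ⟨_, (isOpen_lt continuous_const continuous_norm).mem_nhds ?_, Subset.rfl⟩⟩
  · have : {z : ℂ | ρ i < ‖z‖} ∩ (ball 0 1 \ P) = {z : ℂ | ρ i < ‖z‖ ∧ ‖z‖ < 1} \ P := by
      ext z
      simp [and_assoc]
    rw [this]
    exact isConnected_annulus_diff_countable hP (h0 i).le (h1 i)
  · intro z hz
    have hz' : ‖z‖ = ρ i := by simpa using hfr i hz
    exact ⟨by rw [mem_ball_zero_iff, hz']; exact h1 i, fun hzP => hρP i ⟨z, hzP, hz'⟩⟩
  · exact (isCompact_sphere _ _).of_isClosed_subset isClosed_frontier (hfr i)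
  · exact (hmono hij).trans_lt hz
  · obtain ⟨R, hR, hKR⟩ := exists_lt_subset_ball hK.isClosed (hKF.trans sdiff_subset)
    obtain ⟨n, hn⟩ := exists_nat_one_div_lt (sub_pos.2 hR)
    refine ⟨n, ?_⟩
    rw [disjoint_left]
    intro z hz hzK
    have h2 := mem_ball_zero_iff.1 (hKR hzK)
    have h3 : ρ n < ‖z‖ := hz
    linarith [(hρ n).1]
  · change ρ i < ‖p‖
    rw [hp]
    exact h1 i

/-- The disk without an infinite closed discrete subset is a flute surface. -/
theorem isFluteSurface_ball_diff (hPD : P ⊆ ball 0 1) (hinf : P.Infinite)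
    (hfin : ∀ ρ < 1, (P ∩ closedBall 0 ρ).Finite) :
    IsFluteSurface (ball (0 : ℂ) 1 \ P : Set ℂ) := by
  let φ : ℂ → ℂ := fun z => (Homeomorph.unitBall z : ℂ)
  have hφ : IsEmbedding φ := IsEmbedding.subtypeVal.comp Homeomorph.unitBall.isEmbedding
  have hφrange : range φ = ball 0 1 := by
    change range (Subtype.val ∘ Homeomorph.unitBall) = _
    rw [Homeomorph.unitBall.surjective.range_comp, Subtype.range_coe]
  obtain ⟨h, hh⟩ := exists_homeomorph_image_eq_range_natCast (φ ⁻¹' P)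
    (hinf.preimage (hφrange ▸ hPD)) (fun r => by
      have hK : IsCompact (φ '' closedBall 0 r) :=
        (isCompact_closedBall 0 r).image hφ.continuous
      obtain ⟨ρ, hρ, hsub⟩ := exists_lt_subset_ball hK.isClosed
        (hφrange ▸ image_subset_range φ _)
      refine Finite.of_finite_image ((hfin ρ hρ).subset ?_) hφ.injective.injOn
      rintro _ ⟨z, ⟨hz, hzr⟩, rfl⟩
      exact ⟨hz, ball_subset_closedBall (hsub (mem_image_of_mem φ hzr))⟩)
  have himage : φ '' (φ ⁻¹' P)ᶜ = ball 0 1 \ P := by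
    rw [← preimage_compl, image_preimage_eq_inter_range, hφrange, inter_comm, sdiff_eq]
  have himage' : h '' (φ ⁻¹' P)ᶜ = (range fun n : ℕ => (n : ℂ))ᶜ := by
    rw [image_compl_eq h.bijective, hh]
  exact ⟨(Homeomorph.setCongr himage.symm).trans ((hφ.homeomorphImage _).symm.trans
    ((h.image _).trans (Homeomorph.setCongr himage')))⟩

end PuncturedDisk

/-! ### The triangulation of the punctured disk -/

lemma exists_third_vertex {V : Set ℂ} (hV : V ∈ fareyTriangles) {p q : ℂ} (hp : p ∈ V)
    (hq : q ∈ V) (hpq : p ≠ q) :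
    ∃ r, V = {p, q, r} ∧ signedArea p q r ≠ 0 ∧ openSegment ℝ p q ∈ fareyEdges := by
  obtain ⟨u, v, w, huv, hvw, hwu, rfl⟩ := hV
  have h1 := signedArea_fareyPoint_ne_zero huv hvw hwu
  have h2 := signedArea_fareyPoint_ne_zero hvw hwu huv
  have h3 := signedArea_fareyPoint_ne_zero hwu huv hvw
  have hneg : ∀ {A B C : ℂ}, signedArea A B C ≠ 0 → signedArea B A C ≠ 0 := fun h => by
    rwa [signedArea_swap, neg_ne_zero]
  rcases hp with rfl | rfl | rfl <;> rcases hq with rfl | rfl | rfl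
  · exact absurd rfl hpq
  · exact ⟨fareyPoint w, rfl, h1, u, v, huv, rfl⟩
  · exact ⟨fareyPoint v, by rw [pair_comm], hneg h3, u, w, hwu.symm, rfl⟩
  · exact ⟨fareyPoint w, by rw [insert_comm], hneg h1, v, u, huv.symm, rfl⟩
  · exact absurd rfl hpq
  · exact ⟨fareyPoint u, (triple_rotate _ _ _).symm, h2, v, w, hvw, rfl⟩
  · exact ⟨fareyPoint v, by rw [← triple_rotate, ← triple_rotate], h3, w, u, hwu, rfl⟩
  · exact ⟨fareyPoint u, by rw [insert_comm, triple_rotate, pair_comm, insert_comm],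
      hneg h2, w, v, hvw.symm, rfl⟩
  · exact absurd rfl hpq

/-- The open triangles into which the spokes subdivide the open Farey triangles. -/
def cells (c : fareyTriangles → ℂ) : Set (Set ℂ) :=
  {K | ∃ V : fareyTriangles, ∃ p ∈ (V : Set ℂ), ∃ q ∈ (V : Set ℂ), p ≠ q ∧
    K = interior (convexHull ℝ {c V, p, q})}

lemma countable_spokes (c : fareyTriangles → ℂ) : (spokes c).Countable := by
  have : Countable fareyTriangles := countable_fareyTriangles
  have h : spokes c = ⋃ V : fareyTriangles, openSegment ℝ (c V) '' (V : Set ℂ) := by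
    ext S
    simp [spokes, eq_comm]
  rw [h]
  refine countable_iUnion fun V => Countable.image ?_ _
  obtain ⟨_, u, v, w, -, -, -, rfl⟩ := V
  exact (Set.toFinite _).countable

section Punctures

variable {c : fareyTriangles → ℂ}
  (hc : ∀ V : fareyTriangles, c V ∈ interior (convexHull ℝ (V : Set ℂ)))

include hc

lemma puncture_eq_of_mem {V V' : fareyTriangles}
    (h : c V' ∈ interior (convexHull ℝ (V : Set ℂ))) : V' = V :=
  Subtype.ext (triangle_eq_of_mem_of_mem V'.2 V.2 (hc V') h)

lemma range_punctures_subset_ball : range c ⊆ ball 0 1 := by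
  rintro _ ⟨V, rfl⟩
  exact interior_triangle_subset_ball V.2 (hc V)

lemma infinite_range_punctures : (range c).Infinite := by
  have : Infinite fareyTriangles := infinite_fareyTriangles.to_subtype
  refine infinite_range_of_injective fun V V' h => ?_
  exact puncture_eq_of_mem hc (h ▸ hc V')

lemma finite_range_punctures_inter {ρ : ℝ} (hρ : ρ < 1) : (range c ∩ closedBall 0 ρ).Finite := by
  refine (((finite_triangles_inter_closedBall hρ).preimage
    Subtype.val_injective.injOn).image c).subset ?_
  rintro _ ⟨⟨V, rfl⟩, hV⟩
  exact ⟨V, ⟨V.2, c V, interior_subset (hc V), hV⟩, rfl⟩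

lemma puncture_ne_vertex {V : fareyTriangles} {v : ℂ} (hv : v ∈ (V : Set ℂ)) : c V ≠ v := by
  rintro rfl
  have := interior_triangle_subset_ball V.2 (hc V)
  rw [mem_ball_zero_iff, norm_of_mem_fareyTriangle V.2 hv] at this
  exact lt_irrefl _ this

lemma spoke_subset_triangle {V : fareyTriangles} {v : ℂ} (hv : v ∈ (V : Set ℂ)) :
    openSegment ℝ (c V) v ⊆ interior (convexHull ℝ (V : Set ℂ)) :=
  (convex_convexHull ℝ _).openSegment_interior_self_subset_interior (hc V)
    (subset_convexHull ℝ _ hv)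

lemma cell_subset_triangle {V : fareyTriangles} {p q : ℂ} (hp : p ∈ (V : Set ℂ))
    (hq : q ∈ (V : Set ℂ)) (hpq : p ≠ q) :
    interior (convexHull ℝ {c V, p, q}) ⊆ interior (convexHull ℝ (V : Set ℂ)) := by
  obtain ⟨r, hV, -⟩ := exists_third_vertex V.2 hp hq hpq
  have := hc V
  rw [hV] at this ⊢
  exact cell_subset this

lemma infinite_spokes : (spokes c).Infinite := by
  have hv : ∀ V : fareyTriangles, ∃ v, v ∈ (V : Set ℂ) := by
    rintro ⟨_, u, v, w, -, -, -, rfl⟩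
    exact ⟨_, Or.inl rfl⟩
  choose v hv using hv
  have : Infinite fareyTriangles := infinite_fareyTriangles.to_subtype
  refine infinite_of_injective_forall_mem (f := fun V => openSegment ℝ (c V) (v V)) ?_
    fun V => ⟨V, v V, hv V, rfl⟩
  intro V V' h
  change openSegment ℝ (c V) (v V) = openSegment ℝ (c V') (v V') at h
  obtain ⟨z, hz⟩ : (openSegment ℝ (c V) (v V)).Nonempty :=
    ⟨_, 1 / 2, 1 / 2, by norm_num, by norm_num, by norm_num, rfl⟩
  exact Subtype.ext (triangle_eq_of_mem_of_mem V.2 V'.2 (spoke_subset_triangle hc (hv V) hz)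
    (spoke_subset_triangle hc (hv V') (h ▸ hz)))

lemma disjoint_segments {S S' : Set ℂ} (hS : S ∈ fareyEdges ∪ spokes c)
    (hS' : S' ∈ fareyEdges ∪ spokes c) (hne : S ≠ S') : Disjoint S S' := by
  have hes : ∀ S ∈ fareyEdges, ∀ S' ∈ spokes c, Disjoint S S' := by
    rintro S hS _ ⟨V, v, hv, rfl⟩
    exact ((disjoint_triangle_edge V.2 hS).mono_left (spoke_subset_triangle hc hv)).symm
  rcases hS with hS | hS <;> rcases hS' with hS' | hS'
  · rw [disjoint_left]
    intro z hz hz'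
    obtain ⟨u, v, huv, rfl⟩ := hS
    obtain ⟨x, y, hxy, rfl⟩ := hS'
    exact hne (openSegment_eq_of_mem_of_mem huv hxy hz hz')
  · exact hes S hS S' hS'
  · exact (hes S' hS' S hS).symm
  · obtain ⟨V, v, hv, rfl⟩ := hS
    obtain ⟨V', v', hv', rfl⟩ := hS'
    by_cases hVV : V = V'
    · subst hVV
      have hvv : v ≠ v' := by rintro rfl; exact hne rfl
      obtain ⟨r, hV, hA, -⟩ := exists_third_vertex V.2 hv hv' hvv
      exact disjoint_spokes hA (hV ▸ hc V)
    · rw [disjoint_left]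
      intro z hz hz'
      exact hVV (Subtype.ext (triangle_eq_of_mem_of_mem V.2 V'.2
        (spoke_subset_triangle hc hv hz) (spoke_subset_triangle hc hv' hz')))

lemma disjoint_cells {K K' : Set ℂ} (hK : K ∈ cells c) (hK' : K' ∈ cells c) (hne : K ≠ K') :
    Disjoint K K' := by
  obtain ⟨V, p, hp, q, hq, hpq, rfl⟩ := hK
  obtain ⟨V', p', hp', q', hq', hpq', rfl⟩ := hK'
  by_cases hVV : V = V'
  · subst hVV
    obtain ⟨r, hV, hA, -⟩ := exists_third_vertex V.2 hp hq hpq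
    have hcV := hc V
    rw [hV] at hp' hq' hcV
    have hA' : signedArea r p q ≠ 0 := by rwa [signedArea_rotate, signedArea_rotate]
    have hcV' : c V ∈ interior (convexHull ℝ {r, p, q}) := by
      rwa [triple_rotate, triple_rotate]
    have d1 := disjoint_cell_cell hA hcV
    have d2 := (disjoint_cell_cell hA' hcV').symm
    rcases hp' with rfl | rfl | rfl <;> rcases hq' with rfl | rfl | rfl
    all_goals first
      | exact absurd rfl hpq'
      | exact absurd rfl hne
      | exact d1
      | exact d2
      | (rw [pair_comm p' q'] at hne ⊢
         first
          | exact absurd rfl hne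
          | exact d1
          | exact d2)
  · rw [disjoint_left]
    intro z hz hz'
    exact hVV (Subtype.ext (triangle_eq_of_mem_of_mem V.2 V'.2
      (cell_subset_triangle hc hp hq hpq hz) (cell_subset_triangle hc hp' hq' hpq' hz')))

lemma disjoint_cell_segment {K S : Set ℂ} (hK : K ∈ cells c) (hS : S ∈ fareyEdges ∪ spokes c) :
    Disjoint K S := by
  obtain ⟨V, p, hp, q, hq, hpq, rfl⟩ := hK
  rcases hS with hS | ⟨V', v, hv, rfl⟩
  · exact (disjoint_triangle_edge V.2 hS).mono_left (cell_subset_triangle hc hp hq hpq)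
  · by_cases hVV : V = V'
    · subst hVV
      obtain ⟨r, hV, hA, -⟩ := exists_third_vertex V.2 hp hq hpq
      exact disjoint_cell_spoke hA (hV ▸ hc V) (hV ▸ hv)
    · rw [disjoint_left]
      intro z hz hz'
      exact hVV (Subtype.ext (triangle_eq_of_mem_of_mem V.2 V'.2
        (cell_subset_triangle hc hp hq hpq hz) (spoke_subset_triangle hc hv hz')))

lemma puncturedDisk_eq_union :
    puncturedDisk c = ⋃₀ (fareyEdges ∪ spokes c) ∪ ⋃₀ cells c := by
  have hsub : ∀ (V : fareyTriangles) (z : ℂ), z ∈ interior (convexHull ℝ (V : Set ℂ)) → z ≠ c V →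
      z ∈ puncturedDisk c := by
    refine fun V z hz hne => ⟨interior_triangle_subset_ball V.2 hz, ?_⟩
    rintro ⟨V', rfl⟩
    exact hne (by rw [puncture_eq_of_mem hc hz])
  ext z
  constructor
  · rintro ⟨hz, hzc⟩
    rcases mem_edge_or_mem_triangle (mem_ball_zero_iff.1 hz) with ⟨S, hS, hzS⟩ | ⟨V, hV, hzV⟩
    · exact Or.inl ⟨S, Or.inl hS, hzS⟩
    · have hcV := hc ⟨V, hV⟩
      have hmem := hV
      obtain ⟨u, v, w, huv, hvw, hwu, rfl⟩ := hmem
      rcases mem_subdivision (signedArea_fareyPoint_ne_zero huv hvw hwu) hcV hzV with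
        h | ⟨s, hs, h⟩ | h | h | h
      · exact absurd ⟨_, h.symm⟩ hzc
      · exact Or.inl ⟨_, Or.inr ⟨⟨_, hV⟩, s, hs, rfl⟩, h⟩
      · exact Or.inr ⟨_, ⟨⟨_, hV⟩, _, by simp, _, by simp, huv.fareyPoint_ne, rfl⟩, h⟩
      · exact Or.inr ⟨_, ⟨⟨_, hV⟩, _, by simp, _, by simp, hvw.fareyPoint_ne, rfl⟩, h⟩
      · exact Or.inr ⟨_, ⟨⟨_, hV⟩, _, by simp, _, by simp, hwu.fareyPoint_ne, rfl⟩, h⟩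
  · rintro (⟨S, hS | ⟨V, v, hv, rfl⟩, hz⟩ | ⟨K, ⟨V, p, hp, q, hq, hpq, rfl⟩, hz⟩)
    · refine ⟨?_, ?_⟩
      · obtain ⟨u, v, huv, rfl⟩ := hS
        exact huv.openSegment_subset_ball hz
      · rintro ⟨V, rfl⟩
        exact disjoint_left.1 (disjoint_triangle_edge V.2 hS) (hc V) hz
    · refine hsub V z (spoke_subset_triangle hc hv hz) ?_
      rintro rfl
      exact puncture_ne_vertex hc hv (left_mem_openSegment_iff.1 hz)
    · refine hsub V z (cell_subset_triangle hc hp hq hpq hz) ?_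
      rintro rfl
      obtain ⟨r, hV, hA, -⟩ := exists_third_vertex V.2 hp hq hpq
      exact vertex_notMem_interior_triangle
        (signedArea_ne_zero_of_mem_interior hA (hV ▸ hc V)) hz

lemma locallyFinite_segments {x : ℂ} (hx : x ∈ puncturedDisk c) :
    ∃ U ∈ 𝓝 x, {S ∈ fareyEdges ∪ spokes c | (S ∩ U).Nonempty}.Finite := by
  obtain ⟨ρ, hxρ, hρ⟩ := exists_between (mem_ball_zero_iff.1 hx.1)
  refine ⟨ball 0 ρ, isOpen_ball.mem_nhds (mem_ball_zero_iff.2 hxρ), ?_⟩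
  refine ((finite_edges_inter_closedBall hρ).union
    (((finite_triangles_inter_closedBall hρ).preimage
      Subtype.val_injective.injOn).biUnion (t := fun V : fareyTriangles =>
        openSegment ℝ (c V) '' (V : Set ℂ)) fun V _ => Finite.image _ ?_)).subset ?_
  · obtain ⟨_, u, v, w, -, -, -, rfl⟩ := V
    exact Set.toFinite _
  · rintro S ⟨hS | ⟨V, v, hv, rfl⟩, z, hz, hzρ⟩
    · exact Or.inl ⟨hS, z, hz, ball_subset_closedBall hzρ⟩
    · refine Or.inr (mem_biUnion (x := V) ⟨V.2, z, ?_, ball_subset_closedBall hzρ⟩ ⟨v, hv, rfl⟩)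
      exact interior_subset (spoke_subset_triangle hc hv hz)

/-- The Farey edges and the spokes cut the punctured disk into triangles. -/
theorem isStraightTriangulation_puncturedDisk :
    IsStraightTriangulation (puncturedDisk c) (fareyEdges ∪ spokes c) (cells c) := by
  have hcount : (range c).Countable := by
    have : Countable fareyTriangles := countable_fareyTriangles
    exact countable_range c
  have hcircle : ∀ p : ℂ, ‖p‖ = 1 → p ∉ puncturedDisk c := fun p hp h => by
    have := mem_ball_zero_iff.1 h.1
    linarith
  have hpunct : ∀ V, c V ∉ puncturedDisk c := fun V h => h.2 ⟨V, rfl⟩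
  refine ⟨(infinite_spokes hc).mono subset_union_right,
    countable_fareyEdges.union (countable_spokes c), ?_,
    fun S hS S' hS' hne => disjoint_segments hc hS hS' hne,
    fun x hx => locallyFinite_segments hc hx, ?_,
    fun K hK K' hK' hne => disjoint_cells hc hK hK' hne,
    fun K hK S hS => disjoint_cell_segment hc hK hS, puncturedDisk_eq_union hc⟩
  · rintro _ (⟨u, v, huv, rfl⟩ | ⟨V, v, hv, rfl⟩)
    · have hu := norm_fareyPoint huv.nsq_pos
      have hv := norm_fareyPoint huv.symm.nsq_pos
      exact ⟨_, _, huv.fareyPoint_ne, rfl, hcircle _ hu, hcircle _ hv,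
        exists_endSeq_circle hcount hu, exists_endSeq_circle hcount hv⟩
    · have hv' := norm_of_mem_fareyTriangle V.2 hv
      exact ⟨_, _, puncture_ne_vertex hc hv, rfl, hpunct V, hcircle _ hv',
        exists_endSeq_puncture hcount (range_punctures_subset_ball hc)
          (fun ρ hρ => finite_range_punctures_inter hc hρ) ⟨V, rfl⟩,
        exists_endSeq_circle hcount hv'⟩
  · rintro _ ⟨V, p, hp, q, hq, hpq, rfl⟩
    obtain ⟨r, hV, hA, hE⟩ := exists_third_vertex V.2 hp hq hpq
    refine ⟨c V, p, q, signedArea_ne_zero_of_mem_interior hA (hV ▸ hc V), rfl, hpunct V,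
      hcircle _ (norm_of_mem_fareyTriangle V.2 hp), hcircle _ (norm_of_mem_fareyTriangle V.2 hq),
      Or.inr ⟨V, p, hp, rfl⟩, Or.inl hE, Or.inr ⟨V, q, hq, openSegment_symm ℝ _ _⟩⟩

lemma isFluteSurface_puncturedDisk : IsFluteSurface (puncturedDisk c) :=
  isFluteSurface_ball_diff (range_punctures_subset_ball hc) (infinite_range_punctures hc)
    fun _ hρ => finite_range_punctures_inter hc hρ

end Punctures

end Flute

theorem mainTheorem6 :
    (∀ (X : Type*) [TopologicalSpace X], Flute.IsFluteSurface X →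
      ∃ μ : ℕ → ℝ → X, Flute.IsIdealTriangulation μ) ∧
    (∀ c : Flute.fareyTriangles → ℂ,
      (∀ V : Flute.fareyTriangles, c V ∈ interior (convexHull ℝ (V : Set ℂ))) →
      Flute.IsFluteSurface (Flute.puncturedDisk c) ∧
      ∃ μ : ℕ → ℝ → Flute.puncturedDisk c,
        Flute.IsIdealTriangulation μ ∧
        (Set.range fun i => Subtype.val '' Set.range (μ i)) =
          Flute.fareyEdges ∪ Flute.spokes c) := by
  refine ⟨fun X _ hX => ?_, fun c hc => ⟨Flute.isFluteSurface_puncturedDisk hc,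
    (Flute.isStraightTriangulation_puncturedDisk hc).exists_isIdealTriangulation⟩⟩
  have hne : ∀ V : Flute.fareyTriangles, ∃ z, z ∈ interior (convexHull ℝ (V : Set ℂ)) := by
    rintro ⟨_, u, v, w, huv, hvw, hwu, rfl⟩
    exact Flute.nonempty_interior_triangle (Flute.signedArea_fareyPoint_ne_zero huv hvw hwu)
  choose c hc using hne
  obtain ⟨μ, hμ, -⟩ :=
    (Flute.isStraightTriangulation_puncturedDisk hc).exists_isIdealTriangulation
  obtain ⟨e⟩ := Flute.isFluteSurface_puncturedDisk hc
  obtain ⟨e'⟩ := hX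
  exact ⟨_, hμ.comp_homeomorph (e.trans e'.symm)⟩
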